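/- Let $D\ge 1$, let $\mathcal H$ be a real Hilbert space, and let $a:\mathbb R^D\to\mathcal H$ be a Generalized Laplace dictionary, i.e. there are $\lambda>0$ and $0<p\le 1$ such that $$\langle a(\theta),a(\theta')\rangle=\exp\!\big(-\lambda\|\theta-\theta'\|_p^p\big)\qquad\text{for all }\theta,\theta'\in\mathbb R^D,\qquad \|x\|_p=\Big(\sum_{d=1}^D|x[d]|^p\Big)^{1/p}.$$ Orthogonal Matching Pursuit (OMP) with input $y\in\mathcal H$ starts from the residual $r=y$ and, while $r\ne 0$, performs iterations $t=1,2,\dots$: it selects some $\hat\theta_t\in\arg\max_{\theta\in\mathbb R^D}|\langle a(\theta),r\rangle|$, computes $(\hat c_1,\dots,\hat c_t)\in\arg\min_{b\in\mathbb R^t}\|y-\sum_{\ell=1}^t b_\ell\,a(\hat\theta_\ell)\|$, and sets $r=y-\sum_{\ell=1}^t\hat c_\ell\,a(\hat\theta_\ell)$. Since the maximizers need not be unique, several runs may be possible; a set $\hat S=\{\hat\theta_1,\dots,\hat\theta_{\hat k}\}$ is called a reachable support for $y$ if some run stops (with $r=0$) after $\hat k$ iterations having selected $\hat\theta_1,\dots,\hat\theta_{\hat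 k}$. For a finite set $S\subset\mathbb R^D$ put $\mathrm{Cart}(S)=\prod_{d=1}^D\{\theta[d]:\theta\in S\}$, the smallest Cartesian grid containing $S$. Then for every finite $S^\star\subset\mathbb R^D$, with $k=\mathrm{card}(S^\star)$, OMP achieves exact $\mathrm{Cart}(S^\star)$-delayed recovery of $S^\star$: for every choice of nonzero real coefficients $(c_\theta)_{\theta\in S^\star}$, every reachable support $\hat S$ for $y=\sum_{\theta\in S^\star}c_\theta\,a(\theta)$ satisfies $$S^\star\subseteq\hat S\subseteq\mathrm{Cart}(S^\star).$$ Hence OMP identifies $S^\star$ in at most $\mathrm{card}(\mathrm{Cart}(S^\star))\le k^D$ iterations: for every such $y$, as long as $r\neq0$ the iteration is well defined (any run with $r\ne0$ can be continued by one more iteration), no run has more than $\mathrm{card}(\mathrm{Cart}(S^\star))$ iterations (so that every run, continued as long as possible, stops with $r=0$), and the final coefficients satisfy $\hat c_\ell=c_{\hat\theta_\ell}$ if $\hat\theta_\ell\in S^\star$ and $\hat c_\ell=0$ otherwise. -/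

import Mathlib

open scoped RealInnerProductSpace

noncomputable section

/-- The `ℓ_p` (quasi-)norm `‖x‖_p = (∑_d |x_d|^p)^{1/p}` on `ℝ^D`. -/
def lpQuasiNorm {D : ℕ} (p : ℝ) (x : Fin D → ℝ) : ℝ :=
  (∑ d, |x d| ^ p) ^ (1 / p)

/-- The class of generalized Laplace kernels on `ℝ^D`:
`κ(θ, θ') = exp(-lam ‖θ - θ'‖_p^p)` for some `lam > 0` and some `0 < p ≤ 1`. -/
def IsGeneralizedLaplaceKernel {D : ℕ} (κ : (Fin D → ℝ) → (Fin D → ℝ) → ℝ) : Prop :=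
  ∃ lam p : ℝ, 0 < lam ∧ 0 < p ∧ p ≤ 1 ∧
    ∀ θ θ' : Fin D → ℝ, κ θ θ' = Real.exp (-lam * lpQuasiNorm p (θ - θ') ^ p)

section Dictionary

variable {H : Type*} [NormedAddCommGroup H] [InnerProductSpace ℝ H] {Θ : Type*}

/-- The kernel induced by a parametric dictionary `a`. -/
def inducedKernel (a : Θ → H) (θ θ' : Θ) : ℝ := ⟪a θ, a θ'⟫

/-- A dictionary parametrized by `ℝ^D` is a generalized Laplace dictionary when its induced
kernel is a generalized Laplace kernel. -/
def IsGeneralizedLaplaceDictionary {D : ℕ} (a : (Fin D → ℝ) → H) : Prop :=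
  IsGeneralizedLaplaceKernel (inducedKernel a)

/-- The residual after `t` iterations of OMP: the parameters selected so far are
`sel 0, …, sel (t - 1)`, and the coefficients computed at iteration `t` are
`coef t 0, …, coef t (t - 1)`. In particular the residual at `t = 0` is `y`. -/
def ompResidual (a : Θ → H) (y : H) (sel : ℕ → Θ) (coef : ℕ → ℕ → ℝ) (t : ℕ) : H :=
  y - ∑ l ∈ Finset.range t, coef t l • a (sel l)

/-- `sel` and `coef` record `T` successive iterations of Orthogonal Matching Pursuit with the
dictionary `a` and the input `y`. An iteration is carried out only while the residual is nonzero;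
it selects any global maximizer of `|⟪a θ, r⟫|` over all of `Θ` (the `(t + 1)`-st selected
parameter is `sel t`), and then recomputes all the coefficients by least squares. Only the values
`sel l` and `coef t l` with `l < t ≤ T` (and `l < T`) matter. -/
structure IsOMPRun (a : Θ → H) (y : H) (T : ℕ) (sel : ℕ → Θ) (coef : ℕ → ℕ → ℝ) : Prop where
  residual_ne_zero : ∀ t < T, ompResidual a y sel coef t ≠ 0
  selection : ∀ t < T, ∀ θ : Θ,
    |⟪a θ, ompResidual a y sel coef t⟫| ≤ |⟪a (sel t), ompResidual a y sel coef t⟫|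
  least_squares : ∀ t < T, ∀ b : ℕ → ℝ,
    ‖ompResidual a y sel coef (t + 1)‖ ≤ ‖y - ∑ l ∈ Finset.range (t + 1), b l • a (sel l)‖

/-- OMP with input `y` can stop after exactly `T` iterations having selected
`sel 0, …, sel (T - 1)`, with final coefficients `coef T 0, …, coef T (T - 1)`. -/
def IsOMPOutput (a : Θ → H) (y : H) (T : ℕ) (sel : ℕ → Θ) (coef : ℕ → ℕ → ℝ) : Prop :=
  IsOMPRun a y T sel coef ∧ ompResidual a y sel coef T = 0

/-- `Shat` is a support that OMP can output when run with input `y`. -/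
def IsReachableSupport (a : Θ → H) (y : H) (Shat : Set Θ) : Prop :=
  ∃ (T : ℕ) (sel : ℕ → Θ) (coef : ℕ → ℕ → ℝ),
    IsOMPOutput a y T sel coef ∧ Shat = sel '' Set.Iio T

/-- Exact `G`-delayed recovery of the finite support `S`: for all nonzero coefficients on `S`,
every support reachable from the corresponding input contains `S` and is contained in `G`. -/
def ExactDelayedRecovery (a : Θ → H) (G : Set Θ) (S : Finset Θ) : Prop :=
  ∀ c : Θ → ℝ, (∀ θ ∈ S, c θ ≠ 0) →
    ∀ Shat : Set Θ, IsReachableSupport a (∑ θ ∈ S, c θ • a θ) Shat →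
      (S : Set Θ) ⊆ Shat ∧ Shat ⊆ G

end Dictionary

/-- The smallest Cartesian grid containing `S`: the product over `d` of the sets of `d`-th
coordinates of the elements of `S`. -/
def cartGrid {D : ℕ} (S : Finset (Fin D → ℝ)) : Finset (Fin D → ℝ) :=
  Fintype.piFinset fun d => S.image fun θ => θ d

end

open Filter Topology

/-! The kernel is a product of one-dimensional kernels `φ (x d - y d)` with `φ = laplaceFun lam p`.
If the residual `r` lies in the span of the atoms of a grid, then along any line parallel to an axis
`⟪a θ, r⟫` is a combination of translates of `φ` centred at the grid coordinates. The crux is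
one-dimensional: off its nodes such a combination is strictly smaller in absolute value than any
positive bound valid at the nodes (`abs_kernelSum_lt`). Hence every maximizer of `|⟪a θ, r⟫|` with
`r ≠ 0` is a grid point, and by induction OMP never leaves the grid. Least squares makes the
residual orthogonal to the selected atoms, so no atom is selected twice, which bounds the number of
iterations. Linear independence of the atoms then identifies the coefficients.

The one-dimensional fact rests on the complete maximum principle. It is proved for positive sums of
exponentials `exp (-s * |x|)` by a coupled second-order system (`completeMaximumPrinciple_expSum`),
and it survives pointwise limits. Since `|x| ^ p` is a Bernstein function of `|x|`, `φ` is such a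
limit. Strictness comes from the strict midpoint convexity of `φ` on each side of `0`, applied to
the interpolant of the constant `1`, whose coefficients are nonnegative. -/

/-! ### Linear algebra: diagonalizing a positive operator on a hyperplane. -/

/-- The `e k` diagonalize the compression of `A` to the orthogonal complement of `v`, and `N = ⟪v,
v⟫`. The last inequality is positivity of the Schur complement of that compression. -/
theorem exists_bordered_eigenbasis {E : Type*} [NormedAddCommGroup E] [InnerProductSpace ℝ E]
    [FiniteDimensional ℝ E] (A : E →ₗ[ℝ] E) (hA : A.IsSymmetric)
    (hpos : ∀ x, x ≠ 0 → 0 < ⟪A x, x⟫) (v : E) (hv : v ≠ 0) :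
    ∃ (n : ℕ) (e : Fin n → E) (t u : Fin n → ℝ) (β N : ℝ), 0 < N ∧ (∀ k, ⟪e k, v⟫ = 0) ∧
      (∀ k, 0 < t k) ∧ (∀ k, A (e k) = t k • e k + u k • v) ∧
      A v = β • v + ∑ k, (N * u k) • e k ∧ 0 < β - ∑ k, N * u k ^ 2 / t k := by
  set V : Submodule ℝ E := (ℝ ∙ v)ᗮ
  have hsplit : ∀ x : E, ∃ c : ℝ, x = (V.orthogonalProjectionOnto x : E) + c • v := by
    intro x
    have h1 : x - V.orthogonalProjectionOnto x ∈ Vᗮ := V.sub_starProjection_mem_orthogonal x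
    have h2 : Vᗮ = ℝ ∙ v := Submodule.orthogonal_orthogonal _
    rw [h2, Submodule.mem_span_singleton] at h1
    obtain ⟨c, hc⟩ := h1
    exact ⟨c, by rw [hc]; abel⟩
  have hperp : ∀ x : V, ⟪(x : E), v⟫ = 0 := fun x =>
    Submodule.inner_left_of_mem_orthogonal (Submodule.mem_span_singleton_self v) x.2
  have hN : 0 < ⟪v, v⟫ := real_inner_self_pos.2 hv
  let T : V →ₗ[ℝ] V := V.orthogonalProjectionOnto.toLinearMap ∘ₗ A ∘ₗ V.subtype
  have hTdef : ∀ x : V, T x = V.orthogonalProjectionOnto (A x) := fun x => rfl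
  have hTin : ∀ x y : V, ⟪T x, y⟫ = ⟪A x, (y : E)⟫ := by
    intro x y
    obtain ⟨c, hc⟩ := hsplit (A x)
    rw [hTdef, Submodule.coe_inner]
    conv_rhs => rw [hc]
    rw [inner_add_left, inner_smul_left, real_inner_comm _ v, hperp]
    simp
  have hT : T.IsSymmetric := by
    intro x y
    rw [hTin, ← real_inner_comm x, hTin, ← real_inner_comm (A y)]
    exact hA _ _
  let e := hT.eigenvectorBasis (n := Module.finrank ℝ V) rfl
  let t := hT.eigenvalues (n := Module.finrank ℝ V) rfl
  have het : ∀ k, T (e k) = t k • e k := fun k =>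
    hT.apply_eigenvectorBasis rfl k
  choose u hu using fun k => hsplit (A (e k))
  have hAe : ∀ k, A (e k) = t k • (e k : E) + u k • v := by
    intro k
    conv_lhs => rw [hu k]
    rw [← hTdef, het]; rfl
  have ht : ∀ k, 0 < t k := by
    intro k
    have h1 : ⟪T (e k), e k⟫ = t k := by
      rw [het, inner_smul_left, real_inner_self_eq_norm_sq, e.orthonormal.1 k]; simp
    rw [← h1, hTin]
    apply hpos
    intro h0
    have := e.orthonormal.ne_zero k
    exact this (Subtype.ext h0)
  obtain ⟨β, hβ⟩ := hsplit (A v)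
  have hAv : A v = β • v + ∑ k, (⟪v, v⟫ * u k) • (e k : E) := by
    conv_lhs => rw [hβ]
    rw [add_comm]
    congr 1
    have h1 := e.sum_repr' (V.orthogonalProjectionOnto (A v))
    conv_lhs => rw [← h1]
    push_cast
    refine Finset.sum_congr rfl fun k _ => ?_
    congr 1
    have h2 : ⟪(e k : E), A v⟫ = ⟪e k, V.orthogonalProjectionOnto (A v)⟫ := by
      conv_lhs => rw [hβ]
      rw [inner_add_right, inner_smul_right, hperp, Submodule.coe_inner]; simp
    rw [← h2, ← hA, hAe, inner_add_left, inner_smul_left, inner_smul_left, hperp]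
    simp [mul_comm]
  refine ⟨_, fun k => e k, t, u, β, ⟪v, v⟫, hN, fun k => hperp _, ht, hAe, hAv, ?_⟩
  set c := β - ∑ k, ⟪v, v⟫ * u k ^ 2 / t k with hc
  -- Block elimination: `p` is chosen so that the `e k` components of `A p` cancel, leaving the
  -- Schur complement `c` times `v`.
  let p : E := v - ∑ k, (⟪v, v⟫ * u k / t k) • (e k : E)
  have hpv : ⟪v, p⟫ = ⟪v, v⟫ := by
    simp only [p, inner_sub_right, inner_sum, inner_smul_right]
    simp [real_inner_comm _ v, hperp]
  have hAp : A p = c • v := by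
    simp only [p, map_sub, map_sum, map_smul, hAv, hAe, hc, smul_add, sub_smul,
      Finset.sum_add_distrib, smul_smul, Finset.sum_smul]
    have h1 : ∀ k, ⟪v, v⟫ * u k / t k * t k = ⟪v, v⟫ * u k := fun k => by
      field_simp [(ht k).ne']
    have h2 : ∀ k, ⟪v, v⟫ * u k / t k * u k = ⟪v, v⟫ * u k ^ 2 / t k := fun k => by ring
    simp only [h1, h2]
    abel
  have hp0 : p ≠ 0 := by
    intro h; rw [h, inner_zero_right] at hpv; exact hN.ne hpv
  have := hpos p hp0
  rw [hAp, inner_smul_left, hpv] at this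
  exact pos_of_mul_pos_left (by simpa using this) hN.le

/-! ### The complete maximum principle for sums of exponentials. -/

/-- The complete maximum principle for the kernel `φ (x - y)` on the line: a positive value
of a finite combination of kernel functions is dominated by the value at one of the nodes. -/
def CompleteMaximumPrinciple (φ : ℝ → ℝ) : Prop :=
  ∀ (S : Finset ℝ) (b : ℝ → ℝ) (x : ℝ), ∑ g ∈ S, b g * φ (x - g) ≤ 0 ∨
    ∃ g ∈ S, ∑ g' ∈ S, b g' * φ (x - g') ≤ ∑ g' ∈ S, b g' * φ (g - g')

theorem tendsto_exp_sub_one_sub_div_sq :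
    Tendsto (fun y : ℝ => (Real.exp y - 1 - y) / y ^ 2) (𝓝[≠] 0) (𝓝 (1 / 2)) := by
  have h := Real.exp_sub_sum_range_succ_isLittleO_pow 2
  have h1 : (fun y : ℝ => (Real.exp y - 1 - y) / y ^ 2) =ᶠ[𝓝[≠] 0]
      fun y => (Real.exp y - ∑ i ∈ Finset.range (2 + 1), y ^ i / (i.factorial : ℝ)) / y ^ 2
        + 1 / 2 := by
    filter_upwards [self_mem_nhdsWithin] with y hy
    have hy : y ≠ 0 := hy
    simp [Finset.sum_range_succ]
    field_simp
    ring
  rw [tendsto_congr' h1]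
  have h2 := (h.tendsto_div_nhds_zero.mono_left
    (nhdsWithin_le_nhds (s := {0}ᶜ))).add_const (1 / 2 : ℝ)
  rwa [zero_add] at h2

theorem tendsto_exp_mul_sub_one_sub_div_sq (s : ℝ) :
    Tendsto (fun h : ℝ => (Real.exp (s * h) - 1 - s * h) / h ^ 2) (𝓝[>] 0) (𝓝 (s ^ 2 / 2)) := by
  rcases eq_or_ne s 0 with rfl | hs
  · simp
  have h1 : Tendsto (fun h : ℝ => s * h) (𝓝[>] 0) (𝓝[≠] 0) := by
    refine tendsto_nhdsWithin_iff.2 ⟨?_, ?_⟩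
    · have : Tendsto (fun h : ℝ => s * h) (𝓝 0) (𝓝 (s * 0)) :=
        (continuous_const_mul s).tendsto 0
      simpa using this.mono_left nhdsWithin_le_nhds
    · filter_upwards [self_mem_nhdsWithin] with h hh
      exact mul_ne_zero hs (ne_of_gt hh)
  have h2 := (tendsto_exp_sub_one_sub_div_sq.comp h1).const_mul (s ^ 2)
  rw [show s ^ 2 * (1 / 2) = s ^ 2 / 2 by ring] at h2
  refine h2.congr' ?_
  filter_upwards [self_mem_nhdsWithin] with h hh
  have hh : h ≠ 0 := ne_of_gt hh
  simp only [Function.comp]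
  field_simp

/-- Away from `g` the limit is the second derivative. At `g` the kink contributes `-2 * s / h`,
which the extra term compensates. -/
theorem tendsto_exp_abs_symm_diff (s x g : ℝ) :
    Tendsto (fun h : ℝ => (Real.exp (-s * |x + h - g|) + Real.exp (-s * |x - h - g|)
      - 2 * Real.exp (-s * |x - g|)) / h ^ 2 + if x = g then 2 * s / h else 0)
      (𝓝[>] 0) (𝓝 (s ^ 2 * Real.exp (-s * |x - g|))) := by
  have hm := tendsto_exp_mul_sub_one_sub_div_sq (-s)
  have hp := tendsto_exp_mul_sub_one_sub_div_sq s
  by_cases hxg : x = g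
  · subst hxg
    have h2 := hm.const_mul 2
    rw [show 2 * ((-s) ^ 2 / 2) = s ^ 2 * Real.exp (-s * |x - x|) by simp; ring] at h2
    refine h2.congr' ?_
    filter_upwards [self_mem_nhdsWithin] with h hh
    have hh : 0 < h := hh
    have e1 : |x + h - x| = h := by rw [add_sub_cancel_left, abs_of_pos hh]
    have e2 : |x - h - x| = h := by rw [sub_sub_cancel_left, abs_neg, abs_of_pos hh]
    simp only [e1, e2, sub_self, abs_zero, mul_zero, Real.exp_zero, if_true]
    field_simp
    ring
  · have hd : 0 < |x - g| := abs_pos.2 (sub_ne_zero.2 hxg)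
    have h2 := (hm.add hp).mul_const (Real.exp (-s * |x - g|))
    rw [show ((-s) ^ 2 / 2 + s ^ 2 / 2) = s ^ 2 by ring] at h2
    refine h2.congr' ?_
    filter_upwards [Ioo_mem_nhdsGT hd] with h hh
    have hh0 : h ≠ 0 := hh.1.ne'
    have key : Real.exp (-s * |x + h - g|) + Real.exp (-s * |x - h - g|) =
        (Real.exp (-s * h) + Real.exp (s * h)) * Real.exp (-s * |x - g|) := by
      rw [add_mul, ← Real.exp_add, ← Real.exp_add]
      rcases lt_or_gt_of_ne hxg with hlt | hgt
      · rw [abs_of_neg (sub_neg.2 hlt)] at hh ⊢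
        rw [abs_of_neg (by linarith [hh.2]), abs_of_neg (by linarith [hh.1]), add_comm]
        congr 2 <;> ring
      · rw [abs_of_pos (sub_pos.2 hgt)] at hh ⊢
        rw [abs_of_pos (by linarith [hh.1]), abs_of_pos (by linarith [hh.2])]
        congr 2 <;> ring
    rw [key]
    simp only [hxg, if_false]
    field_simp
    ring

section ExpSum

variable {ι : Type*} [Fintype ι]

/-- A combination of the functions `exp (-s i * |x - g|)`, with separated coefficients `b`, `c`. -/
noncomputable def expComb (S : Finset ℝ) (b : ℝ → ℝ) (s c : ι → ℝ) (x : ℝ) : ℝ :=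
  ∑ g ∈ S, b g * ∑ i, c i * Real.exp (-s i * |x - g|)

theorem expComb_add (S : Finset ℝ) (b : ℝ → ℝ) (s c c' : ι → ℝ) (x : ℝ) :
    expComb S b s (fun i => c i + c' i) x = expComb S b s c x + expComb S b s c' x := by
  simp only [expComb, add_mul, Finset.sum_add_distrib, mul_add]

theorem expComb_const_mul (S : Finset ℝ) (b : ℝ → ℝ) (s c : ι → ℝ) (r x : ℝ) :
    expComb S b s (fun i => r * c i) x = r * expComb S b s c x := by
  simp only [expComb, Finset.mul_sum]
  refine Finset.sum_congr rfl fun g _ => Finset.sum_congr rfl fun i _ => by ring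

theorem expComb_sum {κ : Type*} (K : Finset κ) (S : Finset ℝ) (b : ℝ → ℝ) (s : ι → ℝ)
    (c : κ → ι → ℝ) (x : ℝ) :
    expComb S b s (fun i => ∑ k ∈ K, c k i) x = ∑ k ∈ K, expComb S b s (c k) x := by
  simp only [expComb, Finset.sum_mul, Finset.mul_sum]
  rw [Finset.sum_comm (s := K)]
  refine Finset.sum_congr rfl fun g _ => ?_
  rw [Finset.sum_comm (s := K)]

theorem continuous_expComb (S : Finset ℝ) (b : ℝ → ℝ) (s c : ι → ℝ) :
    Continuous (expComb S b s c) := by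
  unfold expComb; fun_prop

theorem tendsto_expComb_cocompact (S : Finset ℝ) (b : ℝ → ℝ) (s c : ι → ℝ) (hs : ∀ i, 0 < s i) :
    Tendsto (expComb S b s c) (cocompact ℝ) (𝓝 0) := by
  have h : ∀ g i, Tendsto (fun x : ℝ => Real.exp (-s i * |x - g|)) (cocompact ℝ) (𝓝 0) := by
    intro g i
    have h1 : Tendsto (fun x : ℝ => |x - g|) (cocompact ℝ) atTop := by
      have := tendsto_norm_cocompact_atTop (E := ℝ)
      exact this.comp (Homeomorph.subRight g).isClosedEmbedding.tendsto_cocompact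
    have h2 : Tendsto (fun x : ℝ => -(s i * |x - g|)) (cocompact ℝ) atBot :=
      tendsto_neg_atTop_atBot.comp (h1.const_mul_atTop (hs i))
    simp only [neg_mul]
    exact Real.tendsto_exp_atBot.comp h2
  have := tendsto_finsetSum S (f := fun g x => b g * ∑ i, c i * Real.exp (-s i * |x - g|))
    (a := fun g => b g * ∑ i, c i * 0) (x := cocompact ℝ) fun g _ =>
      (tendsto_finsetSum _ fun i _ => (h g i).const_mul (c i)).const_mul (b g)
  simp only [mul_zero, Finset.sum_const_zero] at this
  exact this

theorem exists_max_expComb (S : Finset ℝ) (b : ℝ → ℝ) (s c : ι → ℝ) (hs : ∀ i, 0 < s i) {x₀ : ℝ}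
    (h0 : 0 < expComb S b s c x₀) : ∃ x, ∀ y, expComb S b s c y ≤ expComb S b s c x :=
  (continuous_expComb S b s c).exists_forall_ge' x₀
    (((tendsto_expComb_cocompact S b s c hs).eventually_lt_const h0).mono fun _ h => h.le)

/-- The second-derivative test at a maximum. The condition `∑ i, c i * s i = 0` cancels the kinks,
so that the test remains valid at a node. -/
theorem expComb_sq_nonpos_of_max (S : Finset ℝ) (b : ℝ → ℝ) (s c : ι → ℝ) {x : ℝ}
    (hx : x ∉ S ∨ ∑ i, c i * s i = 0) (hmax : ∀ y, expComb S b s c y ≤ expComb S b s c x) :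
    expComb S b s (fun i => s i ^ 2 * c i) x ≤ 0 := by
  have hlim : Tendsto (fun h : ℝ => ∑ g ∈ S, b g * ∑ i, c i *
      ((Real.exp (-s i * |x + h - g|) + Real.exp (-s i * |x - h - g|)
      - 2 * Real.exp (-s i * |x - g|)) / h ^ 2 + if x = g then 2 * s i / h else 0))
      (𝓝[>] 0) (𝓝 (expComb S b s (fun i => s i ^ 2 * c i) x)) := by
    have : expComb S b s (fun i => s i ^ 2 * c i) x =
        ∑ g ∈ S, b g * ∑ i, c i * (s i ^ 2 * Real.exp (-s i * |x - g|)) := by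
      unfold expComb
      refine Finset.sum_congr rfl fun g _ => ?_
      congr 1
      exact Finset.sum_congr rfl fun i _ => by ring
    rw [this]
    exact tendsto_finsetSum _ fun g _ => (tendsto_finsetSum _ fun i _ =>
      (tendsto_exp_abs_symm_diff (s i) x g).const_mul (c i)).const_mul (b g)
  refine le_of_tendsto hlim ?_
  filter_upwards [self_mem_nhdsWithin] with h hh
  have hh : 0 < h := hh
  have hcorr : ∑ g ∈ S, b g * ∑ i, c i * (if x = g then 2 * s i / h else 0) = 0 := by
    refine Finset.sum_eq_zero fun g hg => ?_
    by_cases hxg : x = g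
    · subst hxg
      have h0 : ∑ i, c i * s i = 0 := hx.resolve_left (not_not_intro hg)
      have : ∑ i, c i * (2 * s i / h) = (∑ i, c i * s i) * (2 / h) := by
        rw [Finset.sum_mul]; exact Finset.sum_congr rfl fun i _ => by ring
      simp [this, h0]
    · simp [hxg]
  have hmain : (∑ g ∈ S, b g * ∑ i, c i *
      ((Real.exp (-s i * |x + h - g|) + Real.exp (-s i * |x - h - g|)
      - 2 * Real.exp (-s i * |x - g|)) / h ^ 2 + if x = g then 2 * s i / h else 0)) =
      (expComb S b s c (x + h) + expComb S b s c (x - h) - 2 * expComb S b s c x) / h ^ 2 := by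
    simp only [mul_add, Finset.sum_add_distrib, hcorr, add_zero]
    simp only [expComb, Finset.mul_sum, ← Finset.sum_add_distrib, ← Finset.sum_sub_distrib,
      Finset.sum_div]
    refine Finset.sum_congr rfl fun g _ => Finset.sum_congr rfl fun i _ => by ring
  rw [hmain]
  exact div_nonpos_of_nonpos_of_nonneg (by linarith [hmax (x + h), hmax (x - h)]) (sq_nonneg h)

/-- Suppose a positive maximum `M` of `f = expComb S b s w` is attained off the nodes. Second
differentiation acts on the components of `f` as `A = diag (s i ^ 2)`. The components along `e k`
have no kinks and satisfy `z'' = t k * z + u k * f` everywhere, so `f ≤ M` bounds `u k * z` below by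
the maximum principle. Inserted in `f'' = β * f + ∑ k, N * u k * z k`, these bounds give `f'' ≥ M`
times the Schur complement, which is positive: a contradiction at the maximum. -/
theorem completeMaximumPrinciple_expSum (s w : ι → ℝ) (hs : ∀ i, 0 < s i) (hw : ∀ i, 0 ≤ w i) :
    CompleteMaximumPrinciple fun x => ∑ i, w i * Real.exp (-s i * |x|) := by
  intro S b x₁
  change expComb S b s w x₁ ≤ 0 ∨ ∃ g ∈ S, expComb S b s w x₁ ≤ expComb S b s w g
  by_contra! hcon
  obtain ⟨hpos, hnode⟩ := hcon
  obtain ⟨x₀, hx₀⟩ := exists_max_expComb S b s w hs hpos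
  have hx₀S : x₀ ∉ S := fun h => absurd (hx₀ x₁) (not_le.2 (hnode x₀ h))
  have hM : 0 < expComb S b s w x₀ := hpos.trans_le (hx₀ x₁)
  set M := expComb S b s w x₀ with hMdef
  -- The scaling is forced: `v i * m i = w i` makes `v` represent `f`, and `m i * s i = v i` makes
  -- orthogonality to `v` the no-kink condition.
  let m : ι → ℝ := fun i => √(w i) / √(s i)
  let v : EuclideanSpace ℝ ι := WithLp.toLp 2 fun i => √(w i) * √(s i)
  have hvm : ∀ i, v i * m i = w i := fun i => by
    have : √(s i) ≠ 0 := (Real.sqrt_pos.2 (hs i)).ne'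
    simp only [v, m]
    field_simp
    exact Real.sq_sqrt (hw i)
  have hms : ∀ i, m i * s i = v i := fun i => by
    have h0 : √(s i) ≠ 0 := (Real.sqrt_pos.2 (hs i)).ne'
    have : √(s i) ^ 2 = s i := Real.sq_sqrt (hs i).le
    simp only [v, m]
    field_simp
    rw [this]
  have hv : v ≠ 0 := by
    intro h0
    have hw0 : ∀ i, w i = 0 := fun i => by rw [← hvm, h0]; simp
    simp [hMdef, expComb, hw0] at hM
  let A : EuclideanSpace ℝ ι →ₗ[ℝ] EuclideanSpace ℝ ι :=
    { toFun := fun x => WithLp.toLp 2 fun i => s i ^ 2 * x i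
      map_add' := fun x y => by ext i; simp [mul_add]
      map_smul' := fun r x => by ext i; simp; ring }
  have hAi : ∀ x i, A x i = s i ^ 2 * x i := fun x i => rfl
  have hA : A.IsSymmetric := fun x y => by
    simp only [PiLp.inner_apply, hAi]
    exact Finset.sum_congr rfl fun i _ => by simp; ring
  have hApos : ∀ x, x ≠ 0 → 0 < ⟪A x, x⟫ := by
    intro x hx
    obtain ⟨j, hj⟩ : ∃ j, x j ≠ 0 := by
      by_contra! h; exact hx (by ext i; simp [h i])
    simp only [PiLp.inner_apply, hAi]
    refine Finset.sum_pos' (fun i _ => ?_) ⟨j, Finset.mem_univ _, ?_⟩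
    · simp only [RCLike.inner_apply, conj_trivial]
      have : x i * (s i ^ 2 * x i) = (s i * x i) ^ 2 := by ring
      rw [this]; positivity
    · simp only [RCLike.inner_apply, conj_trivial]
      have : x j * (s j ^ 2 * x j) = (s j * x j) ^ 2 := by ring
      rw [this]
      have := (hs j).ne'
      positivity
  obtain ⟨n, e, t, u, β, N, hN, hev, ht, hAe, hAv, hc⟩ :=
    exists_bordered_eigenbasis A hA hApos v hv
  let Φ : EuclideanSpace ℝ ι → ℝ → ℝ := fun x => expComb S b s fun i => x i * m i
  have hΦv : ∀ y, Φ v y = expComb S b s w y := fun y => by simp only [Φ, hvm]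
  have hΦA : ∀ x y, expComb S b s (fun i => s i ^ 2 * (x i * m i)) y = Φ (A x) y := fun x y => by
    simp only [Φ, hAi, mul_assoc]
  have hΦe : ∀ k y, Φ (A (e k)) y = t k * Φ (e k) y + u k * Φ v y := fun k y => by
    rw [hAe]
    simp only [Φ, ← expComb_const_mul, ← expComb_add]
    congr 1; ext i; simp; ring
  have hΦAv : ∀ y, Φ (A v) y = β * Φ v y + ∑ k, N * u k * Φ (e k) y := fun y => by
    rw [hAv]
    simp only [Φ, ← expComb_const_mul, ← expComb_add, ← expComb_sum]
    congr 1; ext i; simp [add_mul, Finset.sum_mul, mul_assoc]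
  -- the auxiliary components are bounded below by the maximum principle
  have hz : ∀ k y, -(u k ^ 2 * M / t k) ≤ u k * Φ (e k) y := by
    intro k y
    have hbase : 0 ≤ u k ^ 2 * M / t k := by have := ht k; positivity
    by_contra! hlt
    let c : ι → ℝ := fun i => -u k * (e k i * m i)
    have hcΦ : ∀ y, expComb S b s c y = -u k * Φ (e k) y := fun y => by
      rw [← expComb_const_mul]
    obtain ⟨x, hx⟩ := exists_max_expComb S b s c hs (x₀ := y) (by rw [hcΦ]; linarith)
    -- The maximizer `x` may be a node; orthogonality of `e k` to `v` removes the kink there.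
    have hcs : ∑ i, c i * s i = 0 := by
      have h1 : ∑ i, c i * s i = -u k * ⟪e k, v⟫ := by
        simp only [PiLp.inner_apply, Finset.mul_sum, RCLike.inner_apply, conj_trivial, ← hms, c]
        exact Finset.sum_congr rfl fun i _ => by ring
      rw [h1, hev, mul_zero]
    have h2 := expComb_sq_nonpos_of_max S b s c (Or.inr hcs) hx
    have h3 : expComb S b s (fun i => s i ^ 2 * c i) x = -u k * Φ (A (e k)) x := by
      rw [← hΦA, ← expComb_const_mul]
      congr 1; ext i; simp only [c]; ring
    rw [h3, hΦe, hΦv] at h2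
    have h4 := hx y
    rw [hcΦ, hcΦ] at h4
    have h5 : u k ^ 2 * expComb S b s w x ≤ u k ^ 2 * M :=
      mul_le_mul_of_nonneg_left (hx₀ x) (sq_nonneg _)
    have h6 : t k * (u k * Φ (e k) x) < t k * (-(u k ^ 2 * M / t k)) :=
      mul_lt_mul_of_pos_left (by linarith) (ht k)
    have h7 : t k * (-(u k ^ 2 * M / t k)) = -(u k ^ 2 * M) := by
      field_simp [(ht k).ne']
    nlinarith
  have hf := expComb_sq_nonpos_of_max S b s w (Or.inl hx₀S) hx₀
  have hf2 : expComb S b s (fun i => s i ^ 2 * w i) x₀ = Φ (A v) x₀ := by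
    rw [← hΦA]; simp only [hvm]
  rw [hf2, hΦAv, hΦv, ← hMdef] at hf
  have hsum : -∑ k, N * u k ^ 2 / t k * M ≤ ∑ k, N * u k * Φ (e k) x₀ := by
    rw [← Finset.sum_neg_distrib]
    refine Finset.sum_le_sum fun k _ => ?_
    have := mul_le_mul_of_nonneg_left (hz k x₀) hN.le
    calc _ = N * -(u k ^ 2 * M / t k) := by ring
      _ ≤ _ := this
      _ = _ := by ring
  rw [← Finset.sum_mul] at hsum
  have := mul_pos hc hM
  nlinarith

end ExpSum

/-! ### Pointwise limits of exponential sums and Bernstein functions. -/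

/-- In the topology of pointwise convergence, each fixed `S`, `b`, `x` gives a finite union of
closed conditions. -/
theorem isClosed_completeMaximumPrinciple : IsClosed {φ : ℝ → ℝ | CompleteMaximumPrinciple φ} := by
  simp only [CompleteMaximumPrinciple, Set.ofPred_forall]
  refine isClosed_iInter fun S => isClosed_iInter fun b => isClosed_iInter fun x => ?_
  have hset : {φ : ℝ → ℝ | ∑ g ∈ S, b g * φ (x - g) ≤ 0 ∨
      ∃ g ∈ S, ∑ g' ∈ S, b g' * φ (x - g') ≤ ∑ g' ∈ S, b g' * φ (g - g')} =
      {φ : ℝ → ℝ | ∑ g ∈ S, b g * φ (x - g) ≤ 0} ∪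
      ⋃ g ∈ S, {φ : ℝ → ℝ | ∑ g' ∈ S, b g' * φ (x - g') ≤ ∑ g' ∈ S, b g' * φ (g - g')} := by
    ext φ; simp
  rw [hset]
  refine (isClosed_le (by fun_prop) (by fun_prop)).union ?_
  exact isClosed_biUnion_finset fun g _ => isClosed_le (by fun_prop) (by fun_prop)

/-- The semiring of finite nonnegative combinations of the functions `exp (-s * |x|)`, `0 ≤ s`. -/
def expSumSemiring : Subsemiring (ℝ → ℝ) where
  carrier := {φ | ∃ (ι : Type) (_ : Fintype ι) (w s : ι → ℝ), (∀ i, 0 ≤ w i) ∧ (∀ i, 0 ≤ s i) ∧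
    φ = fun x => ∑ i, w i * Real.exp (-s i * |x|)}
  zero_mem' := ⟨Empty, inferInstance, fun _ => 0, fun _ => 0, by simp, by simp, by ext; simp⟩
  one_mem' := ⟨Unit, inferInstance, fun _ => 1, fun _ => 0, by simp, by simp, by ext; simp⟩
  add_mem' := by
    rintro _ _ ⟨ι, _, w, s, hw, hs, rfl⟩ ⟨κ, _, w', s', hw', hs', rfl⟩
    refine ⟨ι ⊕ κ, inferInstance, Sum.elim w w', Sum.elim s s', ?_, ?_, ?_⟩
    · rintro (i | i) <;> simp [hw, hw']
    · rintro (i | i) <;> simp [hs, hs']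
    · ext x; simp
  mul_mem' := by
    rintro _ _ ⟨ι, _, w, s, hw, hs, rfl⟩ ⟨κ, _, w', s', hw', hs', rfl⟩
    refine ⟨ι × κ, inferInstance, fun i => w i.1 * w' i.2, fun i => s i.1 + s' i.2,
      fun i => mul_nonneg (hw _) (hw' _), fun i => add_nonneg (hs _) (hs' _), ?_⟩
    ext x
    simp only [Pi.mul_apply, Finset.sum_mul_sum, Fintype.sum_prod_type]
    refine Finset.sum_congr rfl fun i _ => Finset.sum_congr rfl fun j _ => ?_
    rw [neg_add, add_mul, Real.exp_add]
    ring

theorem mul_exp_mem_expSumSemiring {w s : ℝ} (hw : 0 ≤ w) (hs : 0 ≤ s) :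
    (fun x : ℝ => w * Real.exp (-s * |x|)) ∈ expSumSemiring :=
  ⟨Unit, inferInstance, fun _ => w, fun _ => s, by simp [hw], by simp [hs], by ext; simp⟩

theorem const_mem_expSumSemiring {w : ℝ} (hw : 0 ≤ w) : (fun _ : ℝ => w) ∈ expSumSemiring := by
  simpa using mul_exp_mem_expSumSemiring hw le_rfl

theorem completeMaximumPrinciple_of_mem_closure {φ : ℝ → ℝ}
    (hφ : φ ∈ expSumSemiring.topologicalClosure) : CompleteMaximumPrinciple φ := by
  suffices h : ∀ φ ∈ expSumSemiring, CompleteMaximumPrinciple φ from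
    closure_minimal h isClosed_completeMaximumPrinciple hφ
  rintro _ ⟨ι, _, w, s, hw, hs, rfl⟩
  -- The semiring allows rate `0`, whereas the principle was proved for positive rates; all rates
  -- are shifted by `ε`.
  have hlim : Tendsto (fun ε x => ∑ i, w i * Real.exp (-(s i + ε) * |x|)) (𝓝[>] (0 : ℝ))
      (𝓝 fun x => ∑ i, w i * Real.exp (-s i * |x|)) := by
    refine tendsto_pi_nhds.2 fun x => ?_
    have : Continuous fun ε : ℝ => ∑ i, w i * Real.exp (-(s i + ε) * |x|) := by fun_prop
    simpa only [add_zero] using (this.tendsto 0).mono_left nhdsWithin_le_nhds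
  refine isClosed_completeMaximumPrinciple.mem_of_tendsto hlim ?_
  filter_upwards [self_mem_nhdsWithin] with ε hε
  exact completeMaximumPrinciple_expSum (fun i => s i + ε) w
    (fun i => add_pos_of_nonneg_of_pos (hs i) hε) hw

/-- The exponential series has nonnegative coefficients, so its partial sums at `φ` stay in the
closed semiring. -/
theorem exp_mem_closure_expSumSemiring {φ : ℝ → ℝ} (hφ : φ ∈ expSumSemiring.topologicalClosure) :
    (fun x => Real.exp (φ x)) ∈ expSumSemiring.topologicalClosure := by
  have hlim : Tendsto (fun n : ℕ => ∑ i ∈ Finset.range n,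
      (fun _ : ℝ => ((i.factorial : ℝ))⁻¹) * φ ^ i) atTop (𝓝 fun x => Real.exp (φ x)) := by
    refine tendsto_pi_nhds.2 fun x => ?_
    have := (NormedSpace.expSeries_div_hasSum_exp (φ x)).tendsto_sum_nat
    rw [← Real.exp_eq_exp_ℝ] at this
    refine this.congr fun n => ?_
    simp only [Finset.sum_apply, Pi.mul_apply, Pi.pow_apply]
    exact Finset.sum_congr rfl fun i _ => by ring
  refine expSumSemiring.isClosed_topologicalClosure.mem_of_tendsto hlim ?_
  filter_upwards with n
  refine sum_mem fun i _ => mul_mem ?_ (pow_mem hφ i)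
  exact expSumSemiring.le_topologicalClosure (const_mem_expSumSemiring (by positivity))

/-- `exp (-t * ψ)` is a pointwise limit of nonnegative exponential sums for every `t ≥ 0`; this
holds when `ψ` is a Bernstein function of `|x|`. -/
def IsBernsteinLike (ψ : ℝ → ℝ) : Prop :=
  ∀ t : ℝ, 0 ≤ t → (fun x => Real.exp (-t * ψ x)) ∈ expSumSemiring.topologicalClosure

theorem isBernsteinLike_abs : IsBernsteinLike fun x => |x| := fun t ht =>
  expSumSemiring.le_topologicalClosure (by simpa using mul_exp_mem_expSumSemiring zero_le_one ht)

/-- `exp (-t * (1 - E)) = exp (-t) * exp (t * E)` with `E = exp (-s * |x|)`, and `t * E` lies in the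
semiring. -/
theorem isBernsteinLike_one_sub_exp {s : ℝ} (hs : 0 ≤ s) :
    IsBernsteinLike fun x => 1 - Real.exp (-s * |x|) := by
  intro t ht
  have h1 := exp_mem_closure_expSumSemiring
    (expSumSemiring.le_topologicalClosure (mul_exp_mem_expSumSemiring ht hs))
  have h2 := expSumSemiring.le_topologicalClosure
    (const_mem_expSumSemiring (Real.exp_pos (-t)).le)
  convert mul_mem h2 h1 using 1
  ext x
  simp only [Pi.mul_apply, ← Real.exp_add]
  ring_nf

theorem IsBernsteinLike.const_mul {ψ : ℝ → ℝ} (h : IsBernsteinLike ψ) {r : ℝ} (hr : 0 ≤ r) :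
    IsBernsteinLike fun x => r * ψ x := by
  intro t ht
  simpa only [← mul_assoc, neg_mul] using h (t * r) (mul_nonneg ht hr)

theorem isBernsteinLike_sum {κ : Type*} (K : Finset κ) {ψ : κ → ℝ → ℝ}
    (h : ∀ k ∈ K, IsBernsteinLike (ψ k)) : IsBernsteinLike fun x => ∑ k ∈ K, ψ k x := by
  intro t ht
  convert prod_mem fun k hk => h k hk t ht using 1
  ext x
  simp only [Finset.prod_apply, Finset.mul_sum, Real.exp_sum]

theorem IsBernsteinLike.of_tendsto {κ : Type*} {l : Filter κ} [l.NeBot] {ψ : κ → ℝ → ℝ}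
    {ψ₀ : ℝ → ℝ} (h : ∀ᶠ k in l, IsBernsteinLike (ψ k))
    (hlim : ∀ x, Tendsto (fun k => ψ k x) l (𝓝 (ψ₀ x))) : IsBernsteinLike ψ₀ := by
  intro t ht
  refine expSumSemiring.isClosed_topologicalClosure.mem_of_tendsto (b := l)
    (f := fun k x => Real.exp (-t * ψ k x)) ?_ (h.mono fun k hk => hk t ht)
  exact tendsto_pi_nhds.2 fun x => (Real.continuous_exp.tendsto _).comp ((hlim x).const_mul _)

/-- The general term of a discretization of `∫ (1 - exp (-x * s)) * s ^ (-p - 1) ds`. -/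
noncomputable def powTerm (q p x : ℝ) (k : ℤ) : ℝ := (1 - Real.exp (-q ^ k * x)) * (q ^ p) ^ (-k)

theorem powTerm_nonneg {q p x : ℝ} (hq : 1 < q) (hx : 0 ≤ x) (k : ℤ) : 0 ≤ powTerm q p x k := by
  have h0 : 0 < q := one_pos.trans hq
  refine mul_nonneg (sub_nonneg.2 (Real.exp_le_one_iff.2 ?_)) (by positivity)
  rw [neg_mul]
  exact neg_nonpos.2 (by positivity)

/-- The terms decay like `(q ^ p) ^ (-k)` as `k → ∞`, and like `(q / q ^ p) ^ k` as `k → -∞` because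
`1 - exp (-z) ≤ z`. The second tail is where `p < 1` enters. -/
theorem summable_powTerm {q p x : ℝ} (hq : 1 < q) (hp0 : 0 < p) (hp1 : p < 1) (hx : 0 ≤ x) :
    Summable (powTerm q p x) := by
  have h0 : 0 < q := one_pos.trans hq
  have hqp : 1 < q ^ p := Real.one_lt_rpow hq hp0
  have hqpq : q ^ p < q := by
    simpa using Real.rpow_lt_rpow_of_exponent_lt hq hp1
  have hqp0 : 0 < q ^ p := one_pos.trans hqp
  refine Summable.of_nat_of_neg ?_ ?_
  · refine Summable.of_nonneg_of_le (fun n => powTerm_nonneg hq hx _) (fun n => ?_)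
      (summable_geometric_of_lt_one (inv_nonneg.2 hqp0.le) (inv_lt_one_of_one_lt₀ hqp))
    have : (q ^ p) ^ (-(n : ℤ)) = (q ^ p)⁻¹ ^ n := by simp
    rw [powTerm, this]
    exact mul_le_of_le_one_left (by positivity) (sub_le_self _ (Real.exp_pos _).le)
  · refine Summable.of_nonneg_of_le (fun n => powTerm_nonneg hq hx _) (fun n => ?_)
      ((summable_geometric_of_lt_one (r := q ^ p / q) (by positivity)
        ((div_lt_one h0).2 hqpq)).mul_left x)
    have : (q ^ p) ^ (-(-(n : ℤ))) = (q ^ p) ^ n := by simp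
    rw [powTerm, this]
    have h1 : 1 - Real.exp (-q ^ (-(n : ℤ)) * x) ≤ q ^ (-(n : ℤ)) * x := by
      have := Real.add_one_le_exp (-q ^ (-(n : ℤ)) * x)
      linarith
    calc _ ≤ (q ^ (-(n : ℤ)) * x) * (q ^ p) ^ n := mul_le_mul_of_nonneg_right h1 (by positivity)
      _ = _ := by rw [div_pow, zpow_neg, zpow_natCast]; ring

/-- Scaling `x` by `q` shifts the summation index by one. The geometric discretization thus keeps
the homogeneity of degree `p` exactly for powers of `q`. -/
theorem tsum_powTerm_mul {q : ℝ} (p x : ℝ) (hq : 1 < q) :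
    ∑' k, powTerm q p (q * x) k = q ^ p * ∑' k, powTerm q p x k := by
  have h0 : 0 < q := one_pos.trans hq
  have hqp0 : 0 < q ^ p := Real.rpow_pos_of_pos h0 p
  rw [← tsum_mul_left, ← (Equiv.addRight (1 : ℤ)).tsum_eq fun k => q ^ p * powTerm q p x k]
  refine tsum_congr fun k => ?_
  simp only [powTerm, Equiv.coe_addRight, zpow_add₀ h0.ne', zpow_one, neg_add, zpow_neg,
    zpow_add₀ hqp0.ne']
  field_simp

theorem tsum_powTerm_zpow {q : ℝ} (p : ℝ) (hq : 1 < q) (m : ℤ) :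
    ∑' k, powTerm q p (q ^ m) k = (q ^ p) ^ m * ∑' k, powTerm q p 1 k := by
  have h0 : 0 < q := one_pos.trans hq
  have hqp0 : 0 < q ^ p := Real.rpow_pos_of_pos h0 p
  induction m with
  | zero => simp
  | succ n ih =>
    rw [zpow_add_one₀ h0.ne', mul_comm, tsum_powTerm_mul p _ hq, ih, zpow_add_one₀ hqp0.ne']
    ring
  | pred n ih =>
    have h1 : q ^ (-(n : ℤ)) = q * q ^ (-(n : ℤ) - 1) := by
      rw [zpow_sub_one₀ h0.ne']; field_simp
    rw [h1, tsum_powTerm_mul p _ hq] at ih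
    rw [zpow_sub_one₀ hqp0.ne']
    field_simp
    linarith

theorem monotone_tsum_powTerm {q p x y : ℝ} (hq : 1 < q) (hp0 : 0 < p) (hp1 : p < 1) (hx : 0 ≤ x)
    (hxy : x ≤ y) : ∑' k, powTerm q p x k ≤ ∑' k, powTerm q p y k := by
  have h0 : 0 < q := one_pos.trans hq
  refine (summable_powTerm hq hp0 hp1 hx).tsum_le_tsum (fun k => ?_)
    (summable_powTerm hq hp0 hp1 (hx.trans hxy))
  refine mul_le_mul_of_nonneg_right (sub_le_sub_left (Real.exp_le_exp.2 ?_) _) (by positivity)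
  have : 0 < q ^ k := by positivity
  nlinarith

theorem tsum_powTerm_one_pos {q p : ℝ} (hq : 1 < q) (hp0 : 0 < p) (hp1 : p < 1) :
    0 < ∑' k, powTerm q p 1 k := by
  refine (summable_powTerm hq hp0 hp1 zero_le_one).tsum_pos
    (powTerm_nonneg hq zero_le_one) 0 ?_
  simp [powTerm]

/-- The normalized sum equals `x ^ p` at powers of `q`. Monotonicity between consecutive powers
costs at most a factor `q ^ p`, which tends to `1` as `q → 1`. -/
theorem tsum_powTerm_div_mem_Icc {q p x : ℝ} (hq : 1 < q) (hp0 : 0 < p) (hp1 : p < 1)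
    (hx : 0 ≤ x) : (∑' k, powTerm q p x k) / ∑' k, powTerm q p 1 k ∈
      Set.Icc (x ^ p / q ^ p) (x ^ p * q ^ p) := by
  have h0 : 0 < q := one_pos.trans hq
  have hqp0 : 0 < q ^ p := Real.rpow_pos_of_pos h0 p
  have hG := tsum_powTerm_one_pos hq hp0 hp1
  rcases hx.eq_or_lt with rfl | hx'
  · simp [powTerm, Real.zero_rpow hp0.ne']
  obtain ⟨m, hm1, hm2⟩ := exists_mem_Ico_zpow hx' hq
  have hpow : ∀ m : ℤ, (q ^ m) ^ p = (q ^ p) ^ m := fun m => by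
    rw [← Real.rpow_intCast, ← Real.rpow_intCast, ← Real.rpow_mul h0.le, ← Real.rpow_mul h0.le,
      mul_comm]
  have a1 := monotone_tsum_powTerm hq hp0 hp1 (by positivity) hm1
  have a2 := monotone_tsum_powTerm hq hp0 hp1 hx hm2.le
  rw [tsum_powTerm_zpow p hq] at a1 a2
  have b1 := Real.rpow_le_rpow (by positivity) hm1 hp0.le
  have b2 := Real.rpow_le_rpow hx hm2.le hp0.le
  rw [hpow] at b1 b2
  rw [zpow_add_one₀ hqp0.ne'] at a2 b2
  constructor
  · rw [div_le_div_iff₀ hqp0 hG]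
    calc _ ≤ ((q ^ p) ^ m * q ^ p) * _ := mul_le_mul_of_nonneg_right b2 hG.le
      _ = ((q ^ p) ^ m * ∑' k, powTerm q p 1 k) * q ^ p := by ring
      _ ≤ _ := mul_le_mul_of_nonneg_right a1 hqp0.le
  · rw [div_le_iff₀ hG]
    refine a2.trans (mul_le_mul_of_nonneg_right ?_ hG.le)
    exact mul_le_mul_of_nonneg_right b1 hqp0.le

theorem isBernsteinLike_tsum_powTerm {q p : ℝ} (hq : 1 < q) (hp0 : 0 < p) (hp1 : p < 1) :
    IsBernsteinLike fun x => ∑' k, powTerm q p |x| k := by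
  have h0 : 0 < q := one_pos.trans hq
  refine IsBernsteinLike.of_tendsto (l := atTop)
    (ψ := fun (K : Finset ℤ) x => ∑ k ∈ K, powTerm q p |x| k) (Eventually.of_forall fun K => ?_)
    fun x => (summable_powTerm hq hp0 hp1 (abs_nonneg x)).hasSum
  refine isBernsteinLike_sum K fun k _ => ?_
  simpa only [powTerm, mul_comm] using
    (isBernsteinLike_one_sub_exp (s := q ^ k) (by positivity)).const_mul
      (r := (q ^ p) ^ (-k)) (by positivity)

theorem isBernsteinLike_abs_rpow {p : ℝ} (hp0 : 0 < p) (hp1 : p ≤ 1) :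
    IsBernsteinLike fun x => |x| ^ p := by
  rcases hp1.eq_or_lt with rfl | hp1
  · simpa using isBernsteinLike_abs
  refine IsBernsteinLike.of_tendsto (l := 𝓝[>] (1 : ℝ))
    (ψ := fun q x => (∑' k, powTerm q p 1 k)⁻¹ * ∑' k, powTerm q p |x| k) ?_ fun x => ?_
  · filter_upwards [self_mem_nhdsWithin] with q hq
    exact (isBernsteinLike_tsum_powTerm hq hp0 hp1).const_mul
      (inv_nonneg.2 (tsum_powTerm_one_pos hq hp0 hp1).le)
  · have hq : Tendsto (fun q : ℝ => q ^ p) (𝓝[>] 1) (𝓝 1) := by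
      have := (Real.continuousAt_rpow_const 1 p (Or.inl one_ne_zero)).tendsto
      rw [Real.one_rpow] at this
      exact this.mono_left nhdsWithin_le_nhds
    refine tendsto_of_tendsto_of_tendsto_of_le_of_le' (g := fun q => |x| ^ p / q ^ p)
      (h := fun q => |x| ^ p * q ^ p) ?_ ?_ ?_ ?_
    · have := (tendsto_const_nhds (x := |x| ^ p)).div hq one_ne_zero
      rw [div_one] at this
      exact this
    · simpa using hq.const_mul (|x| ^ p)
    · filter_upwards [self_mem_nhdsWithin] with q hq
      rw [inv_mul_eq_div]
      exact (tsum_powTerm_div_mem_Icc hq hp0 hp1 (abs_nonneg x)).1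
    · filter_upwards [self_mem_nhdsWithin] with q hq
      rw [inv_mul_eq_div]
      exact (tsum_powTerm_div_mem_Icc hq hp0 hp1 (abs_nonneg x)).2

/-! ### Maximum principle and strict convexity of the one-dimensional kernel. -/

/-- The one-dimensional generalized Laplace kernel as a function of the difference. -/
noncomputable def laplaceFun (lam p x : ℝ) : ℝ := Real.exp (-lam * |x| ^ p)

theorem completeMaximumPrinciple_laplaceFun {lam p : ℝ} (hl : 0 < lam) (hp0 : 0 < p)
    (hp1 : p ≤ 1) : CompleteMaximumPrinciple (laplaceFun lam p) :=
  completeMaximumPrinciple_of_mem_closure (isBernsteinLike_abs_rpow hp0 hp1 lam hl.le)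

/-- Concavity of `r ^ p` bounds `exp (-lam * r ^ p)` by the geometric mean of the two outer values,
which are distinct, so their arithmetic mean is strictly larger. -/
theorem two_mul_laplaceFun_lt {lam p : ℝ} (hl : 0 < lam) (hp0 : 0 < p) (hp1 : p ≤ 1) {δ h : ℝ}
    (hh : 0 < h) (hδ : h ≤ |δ|) :
    2 * laplaceFun lam p δ < laplaceFun lam p (δ + h) + laplaceFun lam p (δ - h) := by
  have hsum : laplaceFun lam p (δ + h) + laplaceFun lam p (δ - h) =
      Real.exp (-lam * (|δ| + h) ^ p) + Real.exp (-lam * (|δ| - h) ^ p) := by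
    unfold laplaceFun
    rcases le_total 0 δ with h0 | h0
    · rw [abs_of_nonneg h0] at *
      rw [abs_of_nonneg (by linarith : 0 ≤ δ + h), abs_of_nonneg (by linarith : 0 ≤ δ - h)]
    · rw [abs_of_nonpos h0] at *
      rw [abs_of_nonpos (by linarith : δ + h ≤ 0), abs_of_nonpos (by linarith : δ - h ≤ 0),
        add_comm]
      congr 4 <;> ring
  rw [hsum, laplaceFun]
  set r := |δ|
  have hconc : (r + h) ^ p + (r - h) ^ p ≤ 2 * r ^ p := by
    have := (Real.concaveOn_rpow hp0.le hp1).2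
      (Set.mem_Ici.2 (by linarith : 0 ≤ r + h)) (Set.mem_Ici.2 (by linarith : 0 ≤ r - h))
      (by norm_num : (0 : ℝ) ≤ 1 / 2) (by norm_num : (0 : ℝ) ≤ 1 / 2) (by norm_num)
    simp only [smul_eq_mul] at this
    rw [show 1 / 2 * (r + h) + 1 / 2 * (r - h) = r by ring] at this
    linarith
  have hlt : (r - h) ^ p < (r + h) ^ p := Real.rpow_lt_rpow (by linarith) (by linarith) hp0
  set A := Real.exp (-lam * (r + h) ^ p / 2) with hA
  set B := Real.exp (-lam * (r - h) ^ p / 2) with hB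
  have hAB : A < B := Real.exp_lt_exp.2 (by nlinarith)
  have e1 : Real.exp (-lam * (r + h) ^ p) = A ^ 2 := by
    rw [hA, sq, ← Real.exp_add]; ring_nf
  have e2 : Real.exp (-lam * (r - h) ^ p) = B ^ 2 := by
    rw [hB, sq, ← Real.exp_add]; ring_nf
  have e3 : Real.exp (-lam * r ^ p) ≤ A * B := by
    rw [hA, hB, ← Real.exp_add]
    exact Real.exp_le_exp.2 (by nlinarith)
  rw [e1, e2]
  nlinarith [sq_pos_of_pos (sub_pos.2 hAB)]

/-! ### Interpolating the constant one and strict domination off the nodes. -/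

section Interpolation

variable {H : Type*} [NormedAddCommGroup H] [InnerProductSpace ℝ H]

theorem exists_inner_sum_eq {ι : Type*} [Fintype ι] {v : ι → H} (hv : LinearIndependent ℝ v)
    (y : ι → ℝ) : ∃ b : ι → ℝ, ∀ i, ⟪v i, ∑ j, b j • v j⟫ = y i := by
  let L : (ι → ℝ) →ₗ[ℝ] (ι → ℝ) :=
    { toFun := fun b i => ⟪v i, ∑ j, b j • v j⟫
      map_add' := fun b b' => by
        ext i; simp [add_smul, Finset.sum_add_distrib, inner_add_right]
      map_smul' := fun r b => by
        ext i; simp [mul_smul, ← Finset.smul_sum, inner_smul_right] }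
  have hL : ∀ b i, L b i = ⟪v i, ∑ j, b j • v j⟫ := fun _ _ => rfl
  have hinj : Function.Injective L := by
    refine (injective_iff_map_eq_zero L).2 fun b hb => ?_
    have h0 : ⟪∑ j, b j • v j, ∑ j, b j • v j⟫ = 0 := by
      rw [sum_inner]
      refine Finset.sum_eq_zero fun i _ => ?_
      rw [inner_smul_left, ← hL, hb]; simp
    ext i
    exact Fintype.linearIndependent_iff.1 hv b (inner_self_eq_zero.1 h0) i
  obtain ⟨b, hb⟩ := LinearMap.injective_iff_surjective.1 hinj y
  exact ⟨b, fun i => by rw [← hL, hb]⟩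

theorem exists_inner_sum_eq_one {Θ : Type*} [DecidableEq Θ] {α : Θ → H}
    (hα : LinearIndependent ℝ α) (X : Finset Θ) :
    ∃ b : Θ → ℝ, ∀ g ∈ X, ⟪α g, ∑ g' ∈ X, b g' • α g'⟫ = 1 := by
  obtain ⟨b, hb⟩ := exists_inner_sum_eq
    (hα.comp (fun g : X => (g : Θ)) Subtype.val_injective) fun _ => 1
  refine ⟨fun g => if h : g ∈ X then b ⟨g, h⟩ else 0, fun g hg => ?_⟩
  rw [← Finset.sum_coe_sort]
  simpa using hb ⟨g, hg⟩

variable {φ : ℝ → ℝ} {α : ℝ → H}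

theorem inner_sum_smul_eq (hgram : ∀ x y, ⟪α x, α y⟫ = φ (x - y)) (X : Finset ℝ) (b : ℝ → ℝ)
    (x : ℝ) : ⟪α x, ∑ g ∈ X, b g • α g⟫ = ∑ g ∈ X, b g * φ (x - g) := by
  simp [inner_sum, inner_smul_right, hgram]

theorem le_one_of_interpolates_one (hφ : CompleteMaximumPrinciple φ) {X : Finset ℝ} {b : ℝ → ℝ}
    (hb : ∀ g ∈ X, ∑ g' ∈ X, b g' * φ (g - g') = 1) (x : ℝ) :
    ∑ g ∈ X, b g * φ (x - g) ≤ 1 := by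
  rcases hφ X b x with h | ⟨g, hg, h⟩
  · exact h.trans zero_le_one
  · exact h.trans (hb g hg).le

/-- Let `ρ` be the difference between the interpolants of `1` on `X` and on `X.erase j`. It is
orthogonal to every node atom except that of `j`, whence `‖ρ‖ ^ 2 = b j * ⟪α j, ρ⟫`, and `⟪α j, ρ⟫ ≥
0` by the maximum principle on `X.erase j`. A negative `b j` would force `ρ = 0`, against linear
independence. -/
theorem coeff_nonneg_of_interpolates_one (hφ : CompleteMaximumPrinciple φ)
    (hα : LinearIndependent ℝ α) (hgram : ∀ x y, ⟪α x, α y⟫ = φ (x - y)) {X : Finset ℝ}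
    {b : ℝ → ℝ} (hb : ∀ g ∈ X, ∑ g' ∈ X, b g' * φ (g - g') = 1) {j : ℝ} (hj : j ∈ X) :
    0 ≤ b j := by
  obtain ⟨b', hb'⟩ := exists_inner_sum_eq_one hα (X.erase j)
  let d : ℝ → ℝ := fun g => b g - if g = j then 0 else b' g
  have hd : ∑ g ∈ X, d g • α g = ∑ g ∈ X, b g • α g - ∑ g ∈ X.erase j, b' g • α g := by
    simp only [d, sub_smul, Finset.sum_sub_distrib]
    congr 1
    rw [← Finset.add_sum_erase _ _ hj]
    simp only [if_true, zero_smul, zero_add]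
    refine Finset.sum_congr rfl fun g hg => ?_
    rw [if_neg (Finset.ne_of_mem_erase hg)]
  have hdj : d j = b j := by simp [d]
  set ρ := ∑ g ∈ X, d g • α g with hρ
  have hin : ∀ g ∈ X, ⟪α g, ρ⟫ = 1 - ⟪α g, ∑ g ∈ X.erase j, b' g • α g⟫ := fun g hg => by
    rw [hd, inner_sub_right, inner_sum_smul_eq hgram, hb g hg]
  have hself : ⟪ρ, ρ⟫ = b j * ⟪α j, ρ⟫ := by
    conv_lhs => rw [hρ, sum_inner]
    rw [Finset.sum_eq_single_of_mem j hj]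
    · rw [inner_smul_left, hdj]; simp [hρ]
    · intro g hg hgj
      rw [inner_smul_left, ← hρ, hin g hg, hb' g (Finset.mem_erase.2 ⟨hgj, hg⟩)]
      simp
  have hnn : 0 ≤ ⟪α j, ρ⟫ := by
    rw [hin j hj, inner_sum_smul_eq hgram, sub_nonneg]
    exact le_one_of_interpolates_one hφ
      (fun g hg => by rw [← inner_sum_smul_eq hgram]; exact hb' g hg) j
  by_contra! hneg
  have h0 : ρ = 0 := inner_self_eq_zero.1 (le_antisymm
    (hself ▸ mul_nonpos_of_nonpos_of_nonneg hneg.le hnn) real_inner_self_nonneg)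
  have := linearIndependent_iff'.1 hα X d h0 j hj
  linarith

theorem lt_one_of_interpolates_one (hφ : CompleteMaximumPrinciple φ)
    (hconv : ∀ δ h, 0 < h → h ≤ |δ| → 2 * φ δ < φ (δ + h) + φ (δ - h))
    (hα : LinearIndependent ℝ α) (hgram : ∀ x y, ⟪α x, α y⟫ = φ (x - y)) {X : Finset ℝ}
    {b : ℝ → ℝ} (hb : ∀ g ∈ X, ∑ g' ∈ X, b g' * φ (g - g') = 1) {x : ℝ} (hx : x ∉ X) :
    ∑ g ∈ X, b g * φ (x - g) < 1 := by
  have hnn : ∀ g ∈ X, 0 ≤ b g := fun g hg => coeff_nonneg_of_interpolates_one hφ hα hgram hb hg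
  by_cases hall : ∀ g ∈ X, b g = 0
  · rw [Finset.sum_eq_zero fun g hg => by rw [hall g hg, zero_mul]]
    exact one_pos
  push Not at hall
  obtain ⟨j, hj, hbj⟩ := hall
  have hpos : ∀ g ∈ X, 0 < |x - g| := fun g hg =>
    abs_pos.2 (sub_ne_zero.2 fun h => hx (h ▸ hg))
  obtain ⟨g₀, hg₀, hmin⟩ := X.exists_min_image (fun g => |x - g|) ⟨j, hj⟩
  -- With the distance to the nearest node as step, `x ± h` never passes a node, so convexity
  -- applies to every translate.
  set h := |x - g₀|
  have hlt : ∑ g ∈ X, b g * (2 * φ (x - g)) <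
      ∑ g ∈ X, b g * (φ (x - g + h) + φ (x - g - h)) := by
    refine Finset.sum_lt_sum (fun g hg => ?_) ⟨j, hj, ?_⟩
    · exact mul_le_mul_of_nonneg_left (hconv _ _ (hpos g₀ hg₀) (hmin g hg)).le (hnn g hg)
    · exact mul_lt_mul_of_pos_left (hconv _ _ (hpos g₀ hg₀) (hmin j hj))
        ((hnn j hj).lt_of_ne' hbj)
  have h1 := le_one_of_interpolates_one hφ hb (x + h)
  have h2 := le_one_of_interpolates_one hφ hb (x - h)
  have e1 : ∑ g ∈ X, b g * (2 * φ (x - g)) = 2 * ∑ g ∈ X, b g * φ (x - g) := by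
    rw [Finset.mul_sum]; exact Finset.sum_congr rfl fun g _ => by ring
  have e2 : ∑ g ∈ X, b g * (φ (x - g + h) + φ (x - g - h)) =
      ∑ g ∈ X, b g * φ (x + h - g) + ∑ g ∈ X, b g * φ (x - h - g) := by
    rw [← Finset.sum_add_distrib]
    refine Finset.sum_congr rfl fun g _ => ?_
    rw [show x - g + h = x + h - g by ring, show x - g - h = x - h - g by ring]; ring
  linarith

/-- Subtracting `M` times the interpolant of `1` makes the combination nonpositive at the nodes,
hence everywhere by the complete maximum principle. Off the nodes that interpolant is strictly below
`1`. -/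
theorem abs_kernelSum_lt (hφ : CompleteMaximumPrinciple φ)
    (hconv : ∀ δ h, 0 < h → h ≤ |δ| → 2 * φ δ < φ (δ + h) + φ (δ - h))
    (hα : LinearIndependent ℝ α) (hgram : ∀ x y, ⟪α x, α y⟫ = φ (x - y)) {X : Finset ℝ}
    {b : ℝ → ℝ} {M : ℝ} (hM : 0 < M) (hle : ∀ g ∈ X, |∑ g' ∈ X, b g' * φ (g - g')| ≤ M)
    {x : ℝ} (hx : x ∉ X) : |∑ g ∈ X, b g * φ (x - g)| < M := by
  obtain ⟨β, hβ⟩ := exists_inner_sum_eq_one hα X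
  simp only [inner_sum_smul_eq hgram] at hβ
  have hlt := lt_one_of_interpolates_one hφ hconv hα hgram hβ hx
  have hcmp : ∀ b' : ℝ → ℝ, (∀ g ∈ X, ∑ g' ∈ X, b' g' * φ (g - g') ≤ M) →
      ∑ g ∈ X, b' g * φ (x - g) < M := by
    intro b' hb'
    have hexp : ∀ y, ∑ g ∈ X, (b' g - M * β g) * φ (y - g) =
        ∑ g ∈ X, b' g * φ (y - g) - M * ∑ g ∈ X, β g * φ (y - g) := fun y => by
      rw [Finset.mul_sum, ← Finset.sum_sub_distrib]
      exact Finset.sum_congr rfl fun g _ => by ring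
    have hx0 : ∑ g ∈ X, (b' g - M * β g) * φ (x - g) ≤ 0 := by
      rcases hφ X (fun g => b' g - M * β g) x with h | ⟨g, hg, h⟩
      · exact h
      · refine h.trans ?_
        rw [hexp, hβ g hg]
        linarith [hb' g hg]
    rw [hexp] at hx0
    nlinarith
  refine abs_lt.2 ⟨?_, hcmp b fun g hg => (le_abs_self _).trans (hle g hg)⟩
  have := hcmp (fun g => -b g) fun g hg => by
    simp only [neg_mul, Finset.sum_neg_distrib]
    exact (neg_le_abs _).trans (hle g hg)
  simp only [neg_mul, Finset.sum_neg_distrib] at this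
  linarith

end Interpolation

/-! ### Linear independence of the atoms. -/

/-- The symmetric second difference of `φ` at `δ` with step `h`. -/
def symmDiff2 (φ : ℝ → ℝ) (δ h : ℝ) : ℝ := φ (δ + h) + φ (δ - h) - 2 * φ δ

theorem tendsto_symmDiff2_div {φ : ℝ → ℝ} {δ : ℝ} (hφ : DifferentiableAt ℝ φ δ) :
    Tendsto (fun h => symmDiff2 φ δ h / h) (𝓝[>] 0) (𝓝 0) := by
  have h1 := hφ.hasDerivAt.tendsto_slope_zero_right
  have h2 : HasDerivAt (fun h => φ (δ - h)) (-deriv φ δ) 0 := by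
    have h3 : HasDerivAt φ (deriv φ δ) (δ - 0) := by simpa using hφ.hasDerivAt
    have h4 := h3.comp 0 ((hasDerivAt_id (0 : ℝ)).const_sub δ)
    rw [mul_neg_one] at h4
    exact h4
  have h3 := h1.add h2.tendsto_slope_zero_right
  rw [add_neg_cancel] at h3
  refine h3.congr fun h => ?_
  simp only [symmDiff2, smul_eq_mul, zero_add, sub_zero]
  ring

theorem symmDiff2_laplaceFun_zero_le {lam p h : ℝ} (hl : 0 < lam) (hp0 : 0 < p) (hp1 : p ≤ 1)
    (hh : 0 < h) (hh1 : h ≤ 1) :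
    symmDiff2 (laplaceFun lam p) 0 h ≤ -(2 * lam / (1 + lam)) * h := by
  have hhp : h ≤ h ^ p := by
    simpa using Real.rpow_le_rpow_of_exponent_ge hh hh1 hp1
  -- Uses `h ≤ h ^ p` for `h ≤ 1`, then `exp (-lam * h) ≤ 1 / (1 + lam * h)`, and bounds the latter
  -- on `(0, 1]` by its chord.
  have h1 : Real.exp (-lam * h ^ p) ≤ 1 - lam / (1 + lam) * h := by
    have h2 : Real.exp (-lam * h ^ p) ≤ Real.exp (-(lam * h)) :=
      Real.exp_le_exp.2 (by nlinarith)
    have h3 : Real.exp (-(lam * h)) ≤ (1 + lam * h)⁻¹ := by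
      rw [Real.exp_neg]
      exact inv_anti₀ (by positivity) (by linarith [Real.add_one_le_exp (lam * h)])
    refine (h2.trans h3).trans ?_
    rw [inv_le_iff_one_le_mul₀ (by positivity)]
    have h4 : (1 - lam / (1 + lam) * h) * (1 + lam * h) - 1 =
        lam ^ 2 * h * (1 - h) / (1 + lam) := by
      field_simp
      ring
    have h5 : 0 ≤ lam ^ 2 * h * (1 - h) / (1 + lam) := by
      have := sub_nonneg.2 hh1
      positivity
    linarith
  simp only [symmDiff2, laplaceFun, zero_add, zero_sub, abs_neg, abs_of_pos hh, abs_zero,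
    Real.zero_rpow hp0.ne', mul_zero, Real.exp_zero]
  have : -(2 * lam / (1 + lam)) * h = -2 * (lam / (1 + lam) * h) := by ring
  linarith

theorem differentiableAt_laplaceFun (lam p : ℝ) {δ : ℝ} (hδ : δ ≠ 0) :
    DifferentiableAt ℝ (laplaceFun lam p) δ := by
  unfold laplaceFun
  have h1 : DifferentiableAt ℝ (fun x : ℝ => |x|) δ := differentiableAt_abs hδ
  exact ((h1.rpow_const (Or.inl (abs_pos.2 hδ).ne')).const_mul (-lam)).exp

/-- The peak at `0` makes the second difference there at least of order `h` in size; elsewhere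
differentiability makes it `o(h)`. -/
theorem tendsto_symmDiff2_laplaceFun_ratio {lam p : ℝ} (hl : 0 < lam) (hp0 : 0 < p) (hp1 : p ≤ 1)
    (δ : ℝ) : Tendsto (fun h => symmDiff2 (laplaceFun lam p) δ h / symmDiff2 (laplaceFun lam p) 0 h)
      (𝓝[>] 0) (𝓝 (if δ = 0 then 1 else 0)) := by
  have hc : 0 < 2 * lam / (1 + lam) := by positivity
  have hmem : ∀ᶠ h : ℝ in 𝓝[>] 0, 0 < h ∧ h ≤ 1 :=
    Filter.mem_of_superset (Ioc_mem_nhdsGT one_pos) fun h hh => hh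
  split_ifs with hδ
  · subst hδ
    refine tendsto_const_nhds.congr' ?_
    filter_upwards [hmem] with h hh
    have := symmDiff2_laplaceFun_zero_le hl hp0 hp1 hh.1 hh.2
    have : symmDiff2 (laplaceFun lam p) 0 h ≠ 0 := by nlinarith [mul_pos hc hh.1]
    exact (div_self this).symm
  · have h1 := (tendsto_symmDiff2_div (differentiableAt_laplaceFun lam p hδ)).abs.div_const
      (2 * lam / (1 + lam))
    rw [abs_zero, zero_div] at h1
    refine squeeze_zero_norm' ?_ h1
    filter_upwards [hmem] with h hh
    have h2 := symmDiff2_laplaceFun_zero_le hl hp0 hp1 hh.1 hh.2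
    have h3 : 2 * lam / (1 + lam) * h ≤ |symmDiff2 (laplaceFun lam p) 0 h| :=
      le_abs.2 (Or.inr (by linarith))
    rw [Real.norm_eq_abs, abs_div, abs_div, div_div, abs_of_pos hh.1]
    exact div_le_div_of_nonneg_left (abs_nonneg _) (mul_pos hh.1 hc) (by linarith)

theorem sum_prod_symmDiff2_eq_zero {ι : Type*} [Fintype ι] [DecidableEq ι] {φ : ℝ → ℝ}
    {S : Finset (ι → ℝ)} {c : (ι → ℝ) → ℝ}
    (hzero : ∀ x : ι → ℝ, ∑ g ∈ S, c g * ∏ d, φ (x d - g d) = 0) (x : ι → ℝ) (h : ℝ) :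
    ∑ g ∈ S, c g * ∏ d, symmDiff2 φ (x d - g d) h = 0 := by
  -- The second difference is a three-point stencil with nodes `n` and weights `w`; expanding the
  -- product gives a combination of shifted instances of `hzero`.
  let n : Fin 3 → ℝ := ![h, -h, 0]
  let w : Fin 3 → ℝ := ![1, 1, -2]
  have hq : ∀ δ, symmDiff2 φ δ h = ∑ e, w e * φ (δ + n e) := fun δ => by
    simp [Fin.sum_univ_three, w, n, symmDiff2]; ring_nf
  have hexp : ∀ g : ι → ℝ, ∏ d, symmDiff2 φ (x d - g d) h =
      ∑ ε : ι → Fin 3, (∏ d, w (ε d)) * ∏ d, φ ((fun d => x d + n (ε d)) d - g d) := fun g => by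
    simp only [hq]
    rw [Finset.prod_univ_sum, Fintype.piFinset_univ]
    refine Finset.sum_congr rfl fun ε _ => ?_
    rw [← Finset.prod_mul_distrib]
    exact Finset.prod_congr rfl fun d _ => by rw [sub_add_eq_add_sub]
  simp only [hexp, Finset.mul_sum]
  rw [Finset.sum_comm]
  refine Finset.sum_eq_zero fun ε _ => ?_
  have := congrArg (fun t => (∏ d, w (ε d)) * t) (hzero fun d => x d + n (ε d))
  simp only [Finset.mul_sum, mul_zero] at this
  rw [← this]
  exact Finset.sum_congr rfl fun g _ => by ring

/-- Second differences in all coordinates at `g₀`, normalized by their value at the peak, isolate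
the coefficient of `g₀` as `h → 0`. -/
theorem coeff_eq_zero_of_sum_prod_laplaceFun_eq_zero {ι : Type*} [Fintype ι] [DecidableEq ι]
    {lam p : ℝ} (hl : 0 < lam) (hp0 : 0 < p) (hp1 : p ≤ 1) {S : Finset (ι → ℝ)}
    {c : (ι → ℝ) → ℝ}
    (hzero : ∀ x : ι → ℝ, ∑ g ∈ S, c g * ∏ d, laplaceFun lam p (x d - g d) = 0) {g₀ : ι → ℝ}
    (hg₀ : g₀ ∈ S) : c g₀ = 0 := by
  set φ := laplaceFun lam p
  have hlim : Tendsto (fun h => ∑ g ∈ S, c g *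
      ∏ d, (symmDiff2 φ (g₀ d - g d) h / symmDiff2 φ 0 h)) (𝓝[>] 0)
      (𝓝 (∑ g ∈ S, c g * ∏ d, if g₀ d - g d = 0 then 1 else 0)) :=
    tendsto_finsetSum _ fun g _ => (tendsto_finsetProd _ fun d _ =>
      tendsto_symmDiff2_laplaceFun_ratio hl hp0 hp1 _).const_mul _
  have h0 : ∀ h, ∑ g ∈ S, c g * ∏ d, (symmDiff2 φ (g₀ d - g d) h / symmDiff2 φ 0 h) = 0 := by
    intro h
    simp only [Finset.prod_div_distrib, ← mul_div_assoc]
    rw [← Finset.sum_div, sum_prod_symmDiff2_eq_zero hzero, zero_div]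
  simp only [h0] at hlim
  have hval := tendsto_nhds_unique hlim tendsto_const_nhds
  rw [Finset.sum_eq_single_of_mem g₀ hg₀] at hval
  · simpa using hval
  · intro g _ hne
    obtain ⟨d, hd⟩ := Function.ne_iff.1 hne
    rw [Finset.prod_eq_zero (Finset.mem_univ d), mul_zero]
    exact if_neg (sub_ne_zero.2 (Ne.symm hd))

theorem linearIndependent_of_inner_eq_prod_laplaceFun {ι H : Type*} [Fintype ι]
    [NormedAddCommGroup H] [InnerProductSpace ℝ H] {lam p : ℝ} (hl : 0 < lam) (hp0 : 0 < p)
    (hp1 : p ≤ 1) {a : (ι → ℝ) → H}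
    (ha : ∀ x y, ⟪a x, a y⟫ = ∏ d, laplaceFun lam p (x d - y d)) : LinearIndependent ℝ a := by
  classical
  refine linearIndependent_iff'.2 fun S c hc g₀ hg₀ => ?_
  refine coeff_eq_zero_of_sum_prod_laplaceFun_eq_zero hl hp0 hp1 (c := c) (fun x => ?_) hg₀
  have := congrArg (fun r => ⟪a x, r⟫) hc
  simpa [inner_sum, inner_smul_right, ha] using this

/-! ### Maximizers of the correlation lie on the grid. -/

section Grid

variable {H : Type*} [NormedAddCommGroup H] [InnerProductSpace ℝ H] {D : ℕ} {lam p : ℝ}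
  {a : (Fin D → ℝ) → H}

theorem IsGeneralizedLaplaceDictionary.exists_inner_eq_prod
    (ha : IsGeneralizedLaplaceDictionary a) : ∃ lam p : ℝ, 0 < lam ∧ 0 < p ∧ p ≤ 1 ∧
      ∀ x y, ⟪a x, a y⟫ = ∏ d, laplaceFun lam p (x d - y d) := by
  obtain ⟨lam, p, hl, hp0, hp1, h⟩ := ha
  refine ⟨lam, p, hl, hp0, hp1, fun x y => ?_⟩
  have h1 := h x y
  have h2 : 0 ≤ ∑ d, |(x - y) d| ^ p :=
    Finset.sum_nonneg fun d _ => Real.rpow_nonneg (abs_nonneg _) _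
  rw [inducedKernel, lpQuasiNorm, ← Real.rpow_mul h2, one_div_mul_cancel hp0.ne',
    Real.rpow_one, Finset.mul_sum, Real.exp_sum] at h1
  exact h1

theorem laplaceFun_zero (hp0 : 0 < p) : laplaceFun lam p 0 = 1 := by
  simp [laplaceFun, Real.zero_rpow hp0.ne']

theorem inner_update_update_eq (hp0 : 0 < p)
    (ha : ∀ x y, ⟪a x, a y⟫ = ∏ d, laplaceFun lam p (x d - y d)) (θ : Fin D → ℝ) (d : Fin D)
    (x y : ℝ) : ⟪a (Function.update θ d x), a (Function.update θ d y)⟫ =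
      laplaceFun lam p (x - y) := by
  rw [ha, Finset.prod_eq_single d]
  · simp
  · intro d' _ hd'
    simp [Function.update_of_ne hd', laplaceFun_zero hp0]
  · simp

theorem exists_inner_update_eq_sum
    (ha : ∀ x y, ⟪a x, a y⟫ = ∏ d, laplaceFun lam p (x d - y d)) {X : Fin D → Finset ℝ} {r : H}
    (hr : r ∈ Submodule.span ℝ (a '' (Fintype.piFinset X : Set (Fin D → ℝ)))) (θ : Fin D → ℝ)
    (d : Fin D) : ∃ b : ℝ → ℝ, ∀ x, ⟪a (Function.update θ d x), r⟫ =
      ∑ g ∈ X d, b g * laplaceFun lam p (x - g) := by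
  induction hr using Submodule.span_induction with
  | mem _ h =>
    obtain ⟨g, hg, rfl⟩ := h
    have hgd : g d ∈ X d := Fintype.mem_piFinset.1 (Finset.mem_coe.1 hg) d
    refine ⟨fun z => if z = g d then
      ∏ d' ∈ Finset.univ.erase d, laplaceFun lam p (θ d' - g d') else 0, fun x => ?_⟩
    rw [Finset.sum_eq_single_of_mem _ hgd (fun z _ hz => by simp [hz]), ha,
      ← Finset.mul_prod_erase _ _ (Finset.mem_univ d)]
    simp only [if_true]
    rw [Function.update_self, mul_comm]
    congr 1
    exact Finset.prod_congr rfl fun d' hd' => by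
      rw [Function.update_of_ne (Finset.ne_of_mem_erase hd')]
  | zero => exact ⟨0, fun x => by simp⟩
  | add r₁ r₂ _ _ h₁ h₂ =>
    obtain ⟨b₁, hb₁⟩ := h₁
    obtain ⟨b₂, hb₂⟩ := h₂
    refine ⟨b₁ + b₂, fun x => ?_⟩
    rw [inner_add_right, hb₁, hb₂, ← Finset.sum_add_distrib]
    exact Finset.sum_congr rfl fun g _ => by simp [add_mul]
  | smul s r _ h =>
    obtain ⟨b, hb⟩ := h
    refine ⟨s • b, fun x => ?_⟩
    rw [inner_smul_right, hb, Finset.mul_sum]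
    exact Finset.sum_congr rfl fun g _ => by simp [mul_assoc]

/-- On an axis-parallel line the other factors of the Gram product are `φ 0 = 1`, so the atoms there
have Gram kernel `φ (x - y)` and `abs_kernelSum_lt` applies. -/
theorem abs_inner_lt_of_notMem (hl : 0 < lam) (hp0 : 0 < p) (hp1 : p ≤ 1)
    (ha : ∀ x y, ⟪a x, a y⟫ = ∏ d, laplaceFun lam p (x d - y d)) {X : Fin D → Finset ℝ} {r : H}
    (hr : r ∈ Submodule.span ℝ (a '' (Fintype.piFinset X : Set (Fin D → ℝ)))) {θ : Fin D → ℝ}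
    {d : Fin D} (hd : θ d ∉ X d) {M : ℝ} (hM : 0 < M)
    (hle : ∀ x ∈ X d, |⟪a (Function.update θ d x), r⟫| ≤ M) : |⟪a θ, r⟫| < M := by
  obtain ⟨b, hb⟩ := exists_inner_update_eq_sum ha hr θ d
  simp only [hb] at hle
  have h := abs_kernelSum_lt (completeMaximumPrinciple_laplaceFun hl hp0 hp1)
    (fun δ h => two_mul_laplaceFun_lt hl hp0 hp1)
    ((linearIndependent_of_inner_eq_prod_laplaceFun hl hp0 hp1 ha).comp
      (Function.update θ d) (Function.update_injective θ d))
    (inner_update_update_eq hp0 ha θ d) hM hle hd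
  rwa [← hb, Function.update_eq_self] at h

theorem eq_zero_of_forall_inner_eq_zero {Θ : Type*} {a : Θ → H} {G : Set Θ} {r : H}
    (hr : r ∈ Submodule.span ℝ (a '' G)) (h : ∀ θ, ⟪a θ, r⟫ = 0) : r = 0 := by
  have : ∀ z ∈ Submodule.span ℝ (a '' G), ⟪z, r⟫ = 0 := fun z hz => by
    induction hz using Submodule.span_induction with
    | mem _ hx => obtain ⟨g, _, rfl⟩ := hx; exact h g
    | zero => simp
    | add _ _ _ _ h1 h2 => rw [inner_add_left, h1, h2, add_zero]
    | smul s _ _ h1 => rw [inner_smul_left, h1, mul_zero]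
  exact inner_self_eq_zero.1 (this r hr)

theorem abs_inner_pos_of_max {Θ : Type*} {a : Θ → H} {G : Set Θ} {r : H}
    (hr : r ∈ Submodule.span ℝ (a '' G)) (hr0 : r ≠ 0) {θ : Θ}
    (hmax : ∀ θ', |⟪a θ', r⟫| ≤ |⟪a θ, r⟫|) : 0 < |⟪a θ, r⟫| := by
  by_contra! h
  exact hr0 (eq_zero_of_forall_inner_eq_zero hr fun θ' =>
    abs_nonpos_iff.1 ((hmax θ').trans h))

theorem mem_piFinset_of_max (hl : 0 < lam) (hp0 : 0 < p) (hp1 : p ≤ 1)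
    (ha : ∀ x y, ⟪a x, a y⟫ = ∏ d, laplaceFun lam p (x d - y d)) {X : Fin D → Finset ℝ} {r : H}
    (hr : r ∈ Submodule.span ℝ (a '' (Fintype.piFinset X : Set (Fin D → ℝ)))) (hr0 : r ≠ 0)
    {θ : Fin D → ℝ} (hmax : ∀ θ', |⟪a θ', r⟫| ≤ |⟪a θ, r⟫|) : θ ∈ Fintype.piFinset X := by
  refine Fintype.mem_piFinset.2 fun d => ?_
  by_contra hd
  exact lt_irrefl _ (abs_inner_lt_of_notMem hl hp0 hp1 ha hr hd (abs_inner_pos_of_max hr hr0 hmax)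
    fun x _ => hmax _)

/-- Any point can be moved onto the grid one coordinate at a time without decreasing `|⟪a θ, r⟫|`,
so the maximum over the finite grid is global. -/
theorem exists_max_abs_inner (hl : 0 < lam) (hp0 : 0 < p) (hp1 : p ≤ 1)
    (ha : ∀ x y, ⟪a x, a y⟫ = ∏ d, laplaceFun lam p (x d - y d)) {X : Fin D → Finset ℝ} {r : H}
    (hr : r ∈ Submodule.span ℝ (a '' (Fintype.piFinset X : Set (Fin D → ℝ)))) (hr0 : r ≠ 0) :
    ∃ θ, ∀ θ', |⟪a θ', r⟫| ≤ |⟪a θ, r⟫| := by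
  have hne : (Fintype.piFinset X).Nonempty := by
    by_contra h
    rw [Finset.not_nonempty_iff_eq_empty] at h
    rw [h] at hr
    simp at hr
    exact hr0 hr
  obtain ⟨g₀, hg₀⟩ := hne
  obtain ⟨θ, -, hθ⟩ := (Fintype.piFinset X).exists_max_image (fun θ => |⟪a θ, r⟫|) ⟨g₀, hg₀⟩
  refine ⟨θ, fun θ' => ?_⟩
  have key : ∀ s : Finset (Fin D), ∃ θ'', (∀ d ∈ s, θ'' d ∈ X d) ∧
      |⟪a θ', r⟫| ≤ |⟪a θ'', r⟫| := by
    intro s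
    induction s using Finset.induction_on with
    | empty => exact ⟨θ', by simp, le_rfl⟩
    | insert d s _ ih =>
      obtain ⟨η, hη, hle⟩ := ih
      by_cases hd : η d ∈ X d
      · exact ⟨η, fun d' hd' => (Finset.mem_insert.1 hd').elim (fun h => h ▸ hd) (hη d'), hle⟩
      obtain ⟨x, hx, hxmax⟩ := (X d).exists_max_image
        (fun x => |⟪a (Function.update η d x), r⟫|) ⟨_, Fintype.mem_piFinset.1 hg₀ d⟩
      refine ⟨Function.update η d x, fun d' hd' => ?_, hle.trans ?_⟩
      · rcases eq_or_ne d' d with rfl | hne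
        · rwa [Function.update_self]
        · rw [Function.update_of_ne hne]
          exact hη d' ((Finset.mem_insert.1 hd').resolve_left hne)
      -- The maximum over the nodes may be `0`, while the strict bound needs a positive `M`; hence
      -- the slack `ε`.
      · refine le_of_forall_pos_le_add fun ε hε => ?_
        exact (abs_inner_lt_of_notMem hl hp0 hp1 ha hr hd (by positivity)
          fun x' hx' => (hxmax x' hx').trans (by linarith)).le
  obtain ⟨η, hη, hle⟩ := key Finset.univ
  exact hle.trans (hθ η (Fintype.mem_piFinset.2 fun d => hη d (Finset.mem_univ d)))

theorem mem_cartGrid_of_mem {S : Finset (Fin D → ℝ)} {θ : Fin D → ℝ} (h : θ ∈ S) :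
    θ ∈ cartGrid S :=
  Fintype.mem_piFinset.2 fun d => Finset.mem_image.2 ⟨θ, h, rfl⟩

theorem card_cartGrid_le (S : Finset (Fin D → ℝ)) : (cartGrid S).card ≤ S.card ^ D := by
  rw [cartGrid, Fintype.card_piFinset]
  exact (Finset.prod_le_prod' fun _ _ => Finset.card_image_le).trans (by simp)

end Grid

/-! ### General facts about OMP runs. -/

section OMP

variable {H : Type*} [NormedAddCommGroup H] [InnerProductSpace ℝ H] {Θ : Type*} {a : Θ → H}
  {y : H} {T : ℕ} {sel : ℕ → Θ} {coef : ℕ → ℕ → ℝ}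

theorem inner_eq_zero_of_forall_norm_le {v r : H} (hv : ‖v‖ = 1)
    (h : ∀ s : ℝ, ‖r‖ ≤ ‖r - s • v‖) : ⟪v, r⟫ = 0 := by
  have h1 := pow_le_pow_left₀ (norm_nonneg _) (h ⟪v, r⟫) 2
  rw [norm_sub_sq_real, inner_smul_right, norm_smul, hv, real_inner_comm v r, mul_one,
    Real.norm_eq_abs, sq_abs] at h1
  have : ⟪v, r⟫ ^ 2 ≤ 0 := by nlinarith
  exact pow_eq_zero_iff two_ne_zero |>.1 (le_antisymm this (sq_nonneg _))

theorem exists_leastSquares (y : H) (v : ℕ → H) (n : ℕ) : ∃ b : ℕ → ℝ, ∀ b' : ℕ → ℝ,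
    ‖y - ∑ l ∈ Finset.range n, b l • v l‖ ≤ ‖y - ∑ l ∈ Finset.range n, b' l • v l‖ := by
  let K := Submodule.span ℝ (v '' (Finset.range n : Set ℕ))
  have : FiniteDimensional ℝ K :=
    FiniteDimensional.span_of_finite ℝ ((Finset.range n).finite_toSet.image v)
  obtain ⟨b, hb⟩ := (Submodule.mem_span_image_finset_iff_exists_fun ℝ).1
    (K.orthogonalProjectionOnto y).2
  refine ⟨fun l => if h : l ∈ Finset.range n then b ⟨l, h⟩ else 0, fun b' => ?_⟩
  have hb' : ∑ l ∈ Finset.range n, (if h : l ∈ Finset.range n then b ⟨l, h⟩ else 0) • v l =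
      K.orthogonalProjectionOnto y := by
    rw [← hb, ← Finset.sum_coe_sort]
    exact Finset.sum_congr rfl fun i _ => by rw [dif_pos i.2]
  have hmem : ∑ l ∈ Finset.range n, b' l • v l ∈ K :=
    Submodule.sum_mem _ fun l hl => Submodule.smul_mem _ _
      (Submodule.subset_span ⟨l, Finset.mem_coe.2 hl, rfl⟩)
  rw [hb']
  have hmin := K.starProjection_minimal y
  refine hmin.le.trans (ciInf_le ⟨0, ?_⟩ (⟨_, hmem⟩ : K))
  rintro _ ⟨x, rfl⟩
  exact norm_nonneg _

theorem ompResidual_congr {sel' : ℕ → Θ} {coef' : ℕ → ℕ → ℝ} {t : ℕ}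
    (hs : ∀ l < t, sel' l = sel l) (hc : coef' t = coef t) :
    ompResidual a y sel' coef' t = ompResidual a y sel coef t := by
  unfold ompResidual
  rw [hc]
  congr 1
  exact Finset.sum_congr rfl fun l hl => by rw [hs l (Finset.mem_range.1 hl)]

theorem ompResidual_mem_span {G : Set Θ} {t : ℕ} (hy : y ∈ Submodule.span ℝ (a '' G))
    (hsel : ∀ l < t, sel l ∈ G) :
    ompResidual a y sel coef t ∈ Submodule.span ℝ (a '' G) :=
  Submodule.sub_mem _ hy (Submodule.sum_mem _ fun l hl => Submodule.smul_mem _ _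
    (Submodule.subset_span ⟨_, hsel l (Finset.mem_range.1 hl), rfl⟩))

theorem IsOMPRun.inner_residual_succ_eq_zero (hrun : IsOMPRun a y T sel coef)
    (hnorm : ∀ θ, ‖a θ‖ = 1) {t l : ℕ} (ht : t < T) (hl : l ≤ t) :
    ⟪a (sel l), ompResidual a y sel coef (t + 1)⟫ = 0 := by
  refine inner_eq_zero_of_forall_norm_le (hnorm _) fun s => ?_
  -- Only the coefficient of `sel l` is perturbed, by `s`.
  refine (hrun.least_squares t ht fun l' => coef (t + 1) l' + if l' = l then s else 0).trans_eq ?_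
  congr 1
  simp [ompResidual, add_smul, Finset.sum_add_distrib, sub_sub, ite_smul,
    Nat.lt_succ_of_le hl]

theorem IsOMPRun.extend (hrun : IsOMPRun a y T sel coef) (hres : ompResidual a y sel coef T ≠ 0)
    (hmax : ∃ θ, ∀ θ', |⟪a θ', ompResidual a y sel coef T⟫| ≤
      |⟪a θ, ompResidual a y sel coef T⟫|) :
    ∃ (sel' : ℕ → Θ) (coef' : ℕ → ℕ → ℝ), (∀ t < T, sel' t = sel t) ∧
      (∀ t ≤ T, coef' t = coef t) ∧ IsOMPRun a y (T + 1) sel' coef' := by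
  obtain ⟨θ, hθ⟩ := hmax
  -- The new parameter has index `T`, while the coefficients it leads to have index `T + 1`; earlier
  -- residuals are unchanged.
  let sel' := Function.update sel T θ
  obtain ⟨b, hb⟩ := exists_leastSquares y (fun l => a (sel' l)) (T + 1)
  let coef' := Function.update coef (T + 1) b
  have hs : ∀ t < T, sel' t = sel t := fun t ht => Function.update_of_ne ht.ne _ _
  have hc : ∀ t ≤ T, coef' t = coef t := fun t ht =>
    Function.update_of_ne (Nat.lt_succ_of_le ht).ne _ _
  have hr : ∀ t ≤ T, ompResidual a y sel' coef' t = ompResidual a y sel coef t := fun t ht =>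
    ompResidual_congr (fun l hl => hs l (hl.trans_le ht)) (hc t ht)
  refine ⟨sel', coef', hs, hc, fun t ht => ?_, fun t ht θ' => ?_, fun t ht b' => ?_⟩
  · rw [hr t (Nat.le_of_lt_succ ht)]
    rcases (Nat.le_of_lt_succ ht).eq_or_lt with rfl | h
    · exact hres
    · exact hrun.residual_ne_zero t h
  · rw [hr t (Nat.le_of_lt_succ ht)]
    rcases (Nat.le_of_lt_succ ht).eq_or_lt with rfl | h
    · simpa [sel'] using hθ θ'
    · rw [hs t h]
      exact hrun.selection t h θ'
  · rcases (Nat.le_of_lt_succ ht).eq_or_lt with rfl | h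
    · simpa [ompResidual, coef'] using hb b'
    · rw [hr (t + 1) h]
      refine (hrun.least_squares t h b').trans_eq ?_
      congr 2
      exact Finset.sum_congr rfl fun l hl => by
        rw [hs l ((Nat.lt_succ_iff.1 (Finset.mem_range.1 hl)).trans_lt h)]

theorem coeff_eq_of_sum_eq_sum [DecidableEq Θ] (ha : LinearIndependent ℝ a) {S : Finset Θ}
    {c : Θ → ℝ} {k : ℕ → ℝ} (hinj : Set.InjOn sel (Set.Iio T))
    (heq : ∑ θ ∈ S, c θ • a θ = ∑ l ∈ Finset.range T, k l • a (sel l)) :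
    (∀ l < T, k l = if sel l ∈ S then c (sel l) else 0) ∧
      ∀ θ ∈ S, c θ ≠ 0 → ∃ l < T, sel l = θ := by
  have hfin : ∑ θ ∈ S, Finsupp.single θ (c θ) =
      ∑ l ∈ Finset.range T, Finsupp.single (sel l) (k l) :=
    ha (by simpa [map_sum] using heq)
  have hval : ∀ θ, (if θ ∈ S then c θ else 0) =
      ∑ l ∈ Finset.range T, if sel l = θ then k l else 0 := fun θ => by
    have := DFunLike.congr_fun hfin θ
    simpa [Finsupp.finsetSum_apply, Finsupp.single_apply] using this
  refine ⟨fun l hl => ?_, fun θ hθ hc => ?_⟩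
  · rw [hval, Finset.sum_eq_single_of_mem l (Finset.mem_range.2 hl), if_pos rfl]
    exact fun l' hl' hne => if_neg fun h => hne (hinj (Finset.mem_range.1 hl') hl h)
  · by_contra! h
    have := hval θ
    rw [if_pos hθ, Finset.sum_eq_zero fun l hl => if_neg (h l (Finset.mem_range.1 hl))] at this
    exact hc this

/-- The residual is orthogonal to all selected atoms, whereas a new selection has positive
correlation with it. -/
theorem IsOMPRun.injOn_sel {G : Set Θ} (hrun : IsOMPRun a y T sel coef)
    (hnorm : ∀ θ, ‖a θ‖ = 1) (hy : y ∈ Submodule.span ℝ (a '' G)) (hsel : ∀ l < T, sel l ∈ G) :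
    Set.InjOn sel (Set.Iio T) := by
  have hne : ∀ l t, l < t → t < T → sel l ≠ sel t := by
    intro l t hlt ht h
    have hpos := abs_inner_pos_of_max
      (ompResidual_mem_span (coef := coef) hy fun l hl => hsel l (hl.trans ht))
      (hrun.residual_ne_zero t ht) (hrun.selection t ht)
    obtain ⟨t, rfl⟩ := Nat.exists_eq_add_one_of_ne_zero (Nat.ne_zero_of_lt hlt)
    rw [← h, hrun.inner_residual_succ_eq_zero hnorm (Nat.lt_of_succ_lt ht)
      (Nat.le_of_lt_succ hlt), abs_zero] at hpos
    exact lt_irrefl _ hpos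
  intro l hl t ht h
  rcases lt_trichotomy l t with hlt | heq | hgt
  · exact absurd h (hne l t hlt ht)
  · exact heq
  · exact absurd h.symm (hne t l hgt hl)

end OMP

/-! ### OMP with a generalized Laplace dictionary. -/

theorem IsOMPRun.sel_mem_piFinset {H : Type*} [NormedAddCommGroup H] [InnerProductSpace ℝ H]
    {D : ℕ} {lam p : ℝ} {a : (Fin D → ℝ) → H} {y : H} {T : ℕ} {sel : ℕ → Fin D → ℝ}
    {coef : ℕ → ℕ → ℝ} (hrun : IsOMPRun a y T sel coef) (hl : 0 < lam) (hp0 : 0 < p)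
    (hp1 : p ≤ 1) (ha : ∀ x y, ⟪a x, a y⟫ = ∏ d, laplaceFun lam p (x d - y d))
    {X : Fin D → Finset ℝ}
    (hy : y ∈ Submodule.span ℝ (a '' (Fintype.piFinset X : Set (Fin D → ℝ)))) {t : ℕ}
    (ht : t < T) : sel t ∈ Fintype.piFinset X := by
  induction t using Nat.strong_induction_on with
  | _ t ih =>
    exact mem_piFinset_of_max hl hp0 hp1 ha
      (ompResidual_mem_span hy fun l hlt => ih l hlt (hlt.trans ht))
      (hrun.residual_ne_zero t ht) (hrun.selection t ht)

/-- OMP with a generalized Laplace dictionary achieves exact `Cart(S)`-delayed recovery of every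
finite support `S`. Moreover, for all nonzero coefficients on `S`, OMP never gets stuck before the
residual vanishes, each of its runs has at most `card Cart(S) ≤ k ^ D` iterations, and the final
coefficients are the true ones on `S` and zero elsewhere. -/
theorem mainTheorem4 {D : ℕ} (hD : 1 ≤ D) {H : Type*} [NormedAddCommGroup H]
    [InnerProductSpace ℝ H] [CompleteSpace H] (a : (Fin D → ℝ) → H)
    (ha : IsGeneralizedLaplaceDictionary a) (S : Finset (Fin D → ℝ)) :
    ExactDelayedRecovery a (cartGrid S : Set (Fin D → ℝ)) S ∧
    (cartGrid S).card ≤ S.card ^ D ∧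
    ∀ c : (Fin D → ℝ) → ℝ, (∀ θ ∈ S, c θ ≠ 0) →
      (∀ (T : ℕ) (sel : ℕ → Fin D → ℝ) (coef : ℕ → ℕ → ℝ),
        IsOMPRun a (∑ θ ∈ S, c θ • a θ) T sel coef →
          T ≤ (cartGrid S).card ∧
          (ompResidual a (∑ θ ∈ S, c θ • a θ) sel coef T ≠ 0 →
            ∃ (sel' : ℕ → Fin D → ℝ) (coef' : ℕ → ℕ → ℝ),
              (∀ t < T, sel' t = sel t) ∧ (∀ t ≤ T, coef' t = coef t) ∧
              IsOMPRun a (∑ θ ∈ S, c θ • a θ) (T + 1) sel' coef')) ∧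
      (∀ (T : ℕ) (sel : ℕ → Fin D → ℝ) (coef : ℕ → ℕ → ℝ),
        IsOMPOutput a (∑ θ ∈ S, c θ • a θ) T sel coef →
          ∀ l < T, (sel l ∈ S → coef T l = c (sel l)) ∧ (sel l ∉ S → coef T l = 0)) := by
  obtain ⟨lam, p, hl, hp0, hp1, hgram⟩ := ha.exists_inner_eq_prod
  have hind := linearIndependent_of_inner_eq_prod_laplaceFun hl hp0 hp1 hgram
  have hnorm : ∀ θ, ‖a θ‖ = 1 := fun θ => by
    have h : ‖a θ‖ ^ 2 = 1 := by
      rw [← real_inner_self_eq_norm_sq, hgram]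
      simp [laplaceFun_zero hp0]
    exact (pow_eq_one_iff_of_nonneg (norm_nonneg _) two_ne_zero).1 h
  obtain ⟨X, hX⟩ : ∃ X : Fin D → Finset ℝ, cartGrid S = Fintype.piFinset X := ⟨_, rfl⟩
  have hsub : ∀ θ ∈ S, θ ∈ cartGrid S := fun θ => mem_cartGrid_of_mem
  have hcard := card_cartGrid_le S
  rw [hX] at hsub hcard ⊢
  have hy : ∀ c : (Fin D → ℝ) → ℝ,
      ∑ θ ∈ S, c θ • a θ ∈ Submodule.span ℝ (a '' (Fintype.piFinset X : Set (Fin D → ℝ))) :=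
    fun c => Submodule.sum_mem _ fun θ hθ => Submodule.smul_mem _ _
      (Submodule.subset_span ⟨θ, hsub θ hθ, rfl⟩)
  have hmem : ∀ (c : (Fin D → ℝ) → ℝ) T sel coef, IsOMPRun a (∑ θ ∈ S, c θ • a θ) T sel coef →
      ∀ l < T, sel l ∈ Fintype.piFinset X := fun c T sel coef hrun l hlT =>
    hrun.sel_mem_piFinset hl hp0 hp1 hgram (hy c) hlT
  have hinj : ∀ (c : (Fin D → ℝ) → ℝ) T sel coef, IsOMPRun a (∑ θ ∈ S, c θ • a θ) T sel coef →
      Set.InjOn sel (Set.Iio T) := fun c T sel coef hrun =>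
    hrun.injOn_sel hnorm (hy c) (hmem c T sel coef hrun)
  have hout : ∀ (c : (Fin D → ℝ) → ℝ) T sel coef,
      IsOMPOutput a (∑ θ ∈ S, c θ • a θ) T sel coef →
      (∀ l < T, coef T l = if sel l ∈ S then c (sel l) else 0) ∧
        ∀ θ ∈ S, c θ ≠ 0 → ∃ l < T, sel l = θ := fun c T sel coef h =>
    coeff_eq_of_sum_eq_sum hind (hinj c T sel coef h.1) (sub_eq_zero.1 h.2)
  refine ⟨?_, hcard, fun c _ => ⟨fun T sel coef hrun => ⟨?_, fun hres => ?_⟩,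
    fun T sel coef h l hlT => ⟨fun hm => ?_, fun hm => ?_⟩⟩⟩
  · rintro c hc _ ⟨T, sel, coef, h, rfl⟩
    refine ⟨fun θ hθ => ?_, ?_⟩
    · obtain ⟨l, hlT, rfl⟩ := (hout c T sel coef h).2 θ hθ (hc θ hθ)
      exact ⟨l, hlT, rfl⟩
    · rintro _ ⟨l, hlT, rfl⟩
      exact hmem c T sel coef h.1 l hlT
  -- The selections inject `Finset.range T` into the grid.
  · have := Finset.card_le_card_of_injOn (s := Finset.range T) sel
      (fun l hlT => hmem c T sel coef hrun l (Finset.mem_range.1 hlT))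
      ((hinj c T sel coef hrun).mono fun l hlT => Finset.mem_range.1 hlT)
    simpa using this
  · exact hrun.extend hres (exists_max_abs_inner hl hp0 hp1 hgram
      (ompResidual_mem_span (hy c) (hmem c T sel coef hrun)) hres)
  · rw [(hout c T sel coef h).1 l hlT, if_pos hm]
  · rw [(hout c T sel coef h).1 l hlT, if_neg hm]
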